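/- Let $R$ be a commutative artin ring with radical $r$, let $I(R/r)$ be the injective envelope of $R/r$, and let $\mathcal{C}$ be a dualizing Krull–Schmidt $R$-variety. That is, $\mathcal{C}$ is a skeletally small additive $R$-linear category with split idempotents and finitely generated $\mathrm{Hom}$-modules. Every object of $\mathcal{C}$ is a finite direct sum of objects with local endomorphism ring. Finally, $D(M)(A)=\mathrm{Hom}_R(M(A),I(R/r))$ induces a duality between the categories $\mathrm{mod}(\mathcal{C})$ and $\mathrm{mod}(\mathcal{C}^{op})$ of finitely presented contravariant functors. Let $\mathrm{maps}(\mathcal{C})$ be the category of morphisms $f\colon A_1\to A_0$ of $\mathcal{C}$ and commutative squares, and let $\Phi\colon\mathrm{maps}(\mathcal{C})\to\mathrm{mod}(\mathcal{C})$ be the functor $\Phi(f)=\mathrm{Coker}\big(\mathcal{C}(-,A_1)\to\mathcal{C}(-,A_0)\big)$. Two maps $(h_1,h_0),(h_1',h_0')$ from $f$ to $g\colon B_1\to B_0$ are homotopic if $h_0-h_0'=gs$ for some $s\colon A_0\to B_1$. Let $C^-(\mathrm{mod}(\mathcal{C}))$ be the category of bounded above complexes, with the exact structure given by the degreewise split short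 exact sequences. Let $P^0(\mathrm{mod}(\mathcal{C}))$ be its full subcategory of complexes $\cdots\to P_1\to P_0\to 0$ of projectives with homology only in degree $0$, with the inherited exact structure, and let $\mathrm{rpdim}$ denote projective dimension relative to that structure. Let $\Psi\big(\cdots\to\mathcal{C}(-,A_1)\xrightarrow{(-,f)}\mathcal{C}(-,A_0)\to0\big)=(f\colon A_1\to A_0)$. Subcategories are full subcategories, given by a class of objects, and $\Phi(\mathcal{T}_{\mathcal{C}})$ means the class of objects isomorphic to some $\Phi(T)$ with $T\in\mathcal{T}_{\mathcal{C}}$. A subcategory $\mathcal{T}_{\mathcal{C}}$ of $\mathrm{maps}(\mathcal{C})$ is *relative tilting* if: 1. every $P\in P^0(\mathrm{mod}(\mathcal{C}))$ with $\Psi(P)\in\mathcal{T}_{\mathcal{C}}$ has finite $\mathrm{rpdim}$; 2. $\mathrm{Ext}^k_{C^-(\mathrm{mod}(\mathcal{C}))}(P,Q)=0$ for all $k\ge1$ and all $P,Q\in P^0(\mathrm{mod}(\mathcal{C}))$ with $\Psi(P),\Psi(Q)\in\mathcal{T}_{\mathcal{C}}$; 3. for every object $A$ of $\mathcal{C}$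 there are $n\ge 0$ and an exact sequence $0\to\mathcal{C}(-,A)_\circ\to P^{(0)}\to\cdots\to P^{(n)}\to0$ in $P^0(\mathrm{mod}(\mathcal{C}))$ with all $\Psi(P^{(i)})\in\mathcal{T}_{\mathcal{C}}$, where $\mathcal{C}(-,A)_\circ$ is $\mathcal{C}(-,A)$ concentrated in degree $0$. A subcategory $\mathcal{T}$ of $\mathrm{mod}(\mathcal{C})$ is *tilting* if every $M\in\mathcal{T}$ has finite projective dimension, $\mathrm{Ext}^k_{\mathrm{mod}(\mathcal{C})}(M,N)=0$ for all $M,N\in\mathcal{T}$ and $k\ge1$, and for every object $A$ of $\mathcal{C}$ there are $n\ge0$ and an exact sequence $0\to\mathcal{C}(-,A)\to M_0\to\cdots\to M_n\to0$ with all $M_i\in\mathcal{T}$. **Theorem.** Let $\mathcal{T}_{\mathcal{C}}$ be a subcategory of $\mathrm{maps}(\mathcal{C})$. (a) If $\mathcal{T}_{\mathcal{C}}$ is relative tilting, then $\Phi(\mathcal{T}_{\mathcal{C}})$ is a tilting subcategory of $\mathrm{mod}(\mathcal{C})$. (b) Suppose that $\mathcal{T}_{\mathcal{C}}$ is closed under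 isomorphism in the category of maps modulo homotopy. Then $\mathcal{T}_{\mathcal{C}}$ is a relative tilting subcategory of $\mathrm{maps}(\mathcal{C})$ if and only if $\Phi(\mathcal{T}_{\mathcal{C}})$ is a tilting subcategory of $\mathrm{mod}(\mathcal{C})$. (c) For every $n\ge0$, one has $\mathrm{rpdim}\,P\le n$ for all $P\in P^0(\mathrm{mod}(\mathcal{C}))$ with $\Psi(P)\in\mathcal{T}_{\mathcal{C}}$ if and only if every object of $\Phi(\mathcal{T}_{\mathcal{C}})$ has projective dimension at most $n$. Hence (a) and (b) also hold when both notions of tilting ask for a uniform bound $n$ on these dimensions. -/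

import Mathlib

open CategoryTheory CategoryTheory.Limits Opposite
open scoped ZeroObject

universe v u w w'

noncomputable section

namespace MapsTilting

/-! ### Relative homological algebra

Throughout, `S` is a class of short sequences `0 ⟶ X₁ ⟶ X₂ ⟶ X₃ ⟶ 0` in a category `E`,
to be thought of as the admissible short exact sequences (conflations) of an exact structure. -/

section Relative

variable {E : Type w} [Category.{w'} E]

/-- `P` is relatively projective: `Hom(P, X₂) ⟶ Hom(P, X₃)` is onto for all conflations. -/
def RelProjective [HasZeroMorphisms E] (S : ObjectProperty (ShortComplex E)) (P : E) : Prop :=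
  ∀ K : ShortComplex E, S K → ∀ f : P ⟶ K.X₃, ∃ g : P ⟶ K.X₂, g ≫ K.g = f

/-- The relative projective dimension of `X` is at most `n`: there is an exact sequence
`0 ⟶ Q_n ⟶ ⋯ ⟶ Q_0 ⟶ X ⟶ 0`, spliced from conflations, with all `Q_i` relatively projective. -/
def RelProjDimLE [HasZeroMorphisms E] (S : ObjectProperty (ShortComplex E)) : ℕ → E → Prop
  | 0, X => RelProjective S X
  | n + 1, X => ∃ K : ShortComplex E, S K ∧ Nonempty (K.X₃ ≅ X) ∧ RelProjective S K.X₂ ∧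
      RelProjDimLE S n K.X₁

/-- There is an exact sequence `0 ⟶ X ⟶ T_0 ⟶ ⋯ ⟶ T_n ⟶ 0`, spliced from conflations,
with all `T_i` in `T`. -/
def HasCoresolution [HasZeroMorphisms E] (S : ObjectProperty (ShortComplex E))
    (T : ObjectProperty E) : ℕ → E → Prop
  | 0, X => T.isoClosure X
  | n + 1, X => ∃ K : ShortComplex E, S K ∧ Nonempty (K.X₁ ≅ X) ∧ T K.X₂ ∧
      HasCoresolution S T n K.X₃

/-- A relative projective resolution `⋯ ⟶ Q_1 ⟶ Q_0 ⟶ X ⟶ 0`, spliced from the conflations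
`0 ⟶ Ω^(k+1) ⟶ Q_k ⟶ Ω^k ⟶ 0`, where `Ω^0 = X`. -/
structure RelResolution [HasZeroMorphisms E] (S : ObjectProperty (ShortComplex E)) (X : E) where
  /-- the relative syzygies -/
  syz : ℕ → E
  /-- the terms -/
  proj : ℕ → E
  syzZeroIso : syz 0 ≅ X
  incl (k : ℕ) : syz (k + 1) ⟶ proj k
  quot (k : ℕ) : proj k ⟶ syz k
  zero (k : ℕ) : incl k ≫ quot k = 0
  conflation (k : ℕ) : S (ShortComplex.mk (incl k) (quot k) (zero k))
  projective (k : ℕ) : RelProjective S (proj k)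

/-- The differential `Q_(k+1) ⟶ Q_k` of a relative projective resolution. -/
def RelResolution.d [HasZeroMorphisms E] {S : ObjectProperty (ShortComplex E)} {X : E}
    (Q : RelResolution S X) (k : ℕ) : Q.proj (k + 1) ⟶ Q.proj k :=
  Q.quot (k + 1) ≫ Q.incl k

/-- `Ext_S^(k+1)(X, Y) = 0`: for a relative projective resolution `Q` of `X`, the complex
`Hom(Q_k, Y) ⟶ Hom(Q_(k+1), Y) ⟶ Hom(Q_(k+2), Y)` is exact in the middle. (By the comparison
theorem it does not matter which `Q` is taken.) -/
def ExtSuccVanishes [HasZeroMorphisms E] (S : ObjectProperty (ShortComplex E)) (k : ℕ)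
    (X Y : E) : Prop :=
  ∃ Q : RelResolution S X, ∀ f : Q.proj (k + 1) ⟶ Y, Q.d (k + 1) ≫ f = 0 →
    ∃ g : Q.proj k ⟶ Y, Q.d k ≫ g = f

end Relative

/-! ### Finitely presented functors -/

section Functors

variable (R : Type v) [CommRing R] (C : Type u) [Category.{v} C] [Preadditive C] [Linear R C]

/-- Auslander's functor `(f : A₁ ⟶ A₀) ↦ Coker ((-, A₁) ⟶ (-, A₀))`, with values in all
functors. -/
def cokerFunctor : Arrow C ⥤ (Cᵒᵖ ⥤ ModuleCat.{v} R) where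
  obj f := cokernel ((linearYoneda R C).map f.hom)
  map {f g} h := cokernel.map _ _ ((linearYoneda R C).map h.left) ((linearYoneda R C).map h.right)
    (by rw [← Functor.map_comp, ← Functor.map_comp]; exact congrArg _ h.w.symm)
  map_id f := by
    apply coequalizer.hom_ext
    simp
  map_comp f g := by
    apply coequalizer.hom_ext
    simp

/-- `M` is finitely presented: there is an exact sequence `(-, A₁) ⟶ (-, A₀) ⟶ M ⟶ 0`. -/
def finPres : ObjectProperty (Cᵒᵖ ⥤ ModuleCat.{v} R) :=
  fun M => ∃ f : Arrow C, Nonempty ((cokerFunctor R C).obj f ≅ M)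

/-- The category `mod(C)` of finitely presented contravariant functors on `C`. -/
abbrev FPMod : Type (max u (v + 1)) := (finPres R C).FullSubcategory

/-- The short sequences in `mod(C)` that are exact. -/
def exactSeq : ObjectProperty (ShortComplex (FPMod R C)) :=
  fun K => (K.map (finPres R C).ι).ShortExact

/-- The functor `Φ : maps(C) ⥤ mod(C)`; objects of `maps(C)` are the arrows of `C` and morphisms
are the commutative squares. -/
def Phi : Arrow C ⥤ FPMod R C :=
  (finPres R C).lift (cokerFunctor R C) (fun f => ⟨f, ⟨Iso.refl _⟩⟩)

variable {C} in
theorem finPres_linearYoneda [HasZeroObject C] (A : C) :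
    finPres R C ((linearYoneda R C).obj A) := by
  have h0 : IsZero ((linearYoneda R C).obj (0 : C)) := by
    rw [Functor.isZero_iff]
    intro X
    have : Subsingleton (((linearYoneda R C).obj (0 : C)).obj X) :=
      ⟨fun a b => (isZero_zero C).eq_of_tgt a b⟩
    exact ModuleCat.isZero_of_subsingleton _
  refine ⟨Arrow.mk (0 : (0 : C) ⟶ A), ⟨?_⟩⟩
  have hz : (linearYoneda R C).map (0 : (0 : C) ⟶ A) = 0 := h0.eq_of_src _ _
  exact cokernelIsoOfEq hz ≪≫ cokernelZeroIsoTarget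

/-- The functor `C ⥤ mod(C)`, `A ↦ (-, A)`. -/
def yonedaFP [HasZeroObject C] : C ⥤ FPMod R C :=
  (finPres R C).lift (linearYoneda R C) (finPres_linearYoneda R)

instance [HasZeroObject C] : HasZeroObject (FPMod R C) := by
  refine ⟨⟨(yonedaFP R C).obj 0, ?_⟩⟩
  rw [IsZero.iff_id_eq_zero, ← (yonedaFP R C).map_id, (isZero_zero C).eq_of_src (𝟙 (0 : C)) 0]
  ext X f
  exact comp_zero

variable {C} in
theorem relProjective_yonedaFP [HasZeroObject C] (A : C) :
    RelProjective (exactSeq R C) ((yonedaFP R C).obj A) := by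
  intro K hK f
  have hepi : Epi K.g.hom := hK.epi_g
  have hs : ∀ (M N : Cᵒᵖ ⥤ ModuleCat.{v} R) (p : M ⟶ N), Epi p →
      Function.Surjective (p.app (op A)) := fun M N p hp =>
    (ModuleCat.epi_iff_surjective _).1 inferInstance
  obtain ⟨x, hx⟩ := hs _ _ K.g.hom hepi (f.hom.app (op A) (𝟙 A : A ⟶ A))
  obtain ⟨φ, ⟨e⟩⟩ := K.X₂.property
  let q : (linearYoneda R C).obj φ.right ⟶ K.X₂.obj :=
    cokernel.π ((linearYoneda R C).map φ.hom) ≫ e.hom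
  have hq : Epi q := by
    have h1 : Epi (cokernel.π ((linearYoneda R C).map φ.hom)) := inferInstance
    have h2 : Epi e.hom := IsIso.epi_of_iso e.hom
    exact epi_comp' h1 h2
  obtain ⟨a, ha⟩ := hs _ _ q hq x
  refine ⟨ObjectProperty.homMk ((linearYoneda R C).map (a : A ⟶ φ.right) ≫ q), ?_⟩
  have key : ∀ (N : Cᵒᵖ ⥤ ModuleCat.{v} R) (s t : (linearYoneda R C).obj A ⟶ N),
      s.app (op A) (𝟙 A : A ⟶ A) = t.app (op A) (𝟙 A : A ⟶ A) → s = t := by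
    intro N s t h
    ext X b
    have hs := NatTrans.naturality_apply s (b : X.unop ⟶ A).op (𝟙 A : A ⟶ A)
    have ht := NatTrans.naturality_apply t (b : X.unop ⟶ A).op (𝟙 A : A ⟶ A)
    have hb : ((linearYoneda R C).obj A).map (b : X.unop ⟶ A).op (𝟙 A : A ⟶ A) = b :=
      Category.comp_id (b : X.unop ⟶ A)
    rw [hb] at hs ht
    exact hs.trans ((congrArg _ h).trans ht.symm)
  apply ObjectProperty.hom_ext
  apply key
  have h1 : ((linearYoneda R C).map (a : A ⟶ φ.right)).app (op A) (𝟙 A : A ⟶ A) = a :=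
    Category.id_comp (a : A ⟶ φ.right)
  change K.g.hom.app (op A) (q.app (op A)
    (((linearYoneda R C).map (a : A ⟶ φ.right)).app (op A) (𝟙 A : A ⟶ A))) = _
  rw [h1, ha, hx]
  rfl

/-! ### Tilting subcategories of `mod(C)` -/

/-- A full subcategory of `mod(C)`, given by its class of objects `T`, is tilting. -/
structure IsTilting [HasZeroObject C] (T : ObjectProperty (FPMod R C)) : Prop where
  pdim : ∀ M, T M → ∃ n, RelProjDimLE (exactSeq R C) n M
  ext : ∀ M N, T M → T N → ∀ k, ExtSuccVanishes (exactSeq R C) k M N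
  cores : ∀ A : C, ∃ n, HasCoresolution (exactSeq R C) T n ((yonedaFP R C).obj A)

/-! ### The exact categories `C⁻(mod(C))` and `P⁰(mod(C))`

Complexes are indexed cohomologically, so the homological degree `i` is the degree `-i` here. -/

/-- Complexes in `mod(C)` that are bounded above. -/
def boundedAbove : ObjectProperty (CochainComplex (FPMod R C) ℤ) :=
  fun K => ∃ n : ℤ, ∀ i : ℤ, n < i → IsZero (K.X i)

/-- The category `C⁻(mod(C))`. -/
abbrev CMinus : Type (max u (v + 1)) := (boundedAbove R C).FullSubcategory

/-- The exact structure of `C⁻(mod(C))`: the short sequences that split in every degree. -/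
def degreewiseSplit : ObjectProperty (ShortComplex (CMinus R C)) :=
  fun K => ∀ i : ℤ, Nonempty
    (K.map ((boundedAbove R C).ι ⋙ HomologicalComplex.eval (FPMod R C) _ i)).Splitting

/-- Projective resolutions: complexes `⋯ ⟶ P_1 ⟶ P_0 ⟶ 0` of projective objects of `mod(C)`
whose homology vanishes outside degree `0`. -/
def projRes : ObjectProperty (CMinus R C) := fun P =>
  (∀ i : ℤ, 0 < i → IsZero (P.obj.X i)) ∧
  (∀ i : ℤ, RelProjective (exactSeq R C) (P.obj.X i)) ∧
  ∀ i : ℤ, i ≠ 0 → (((finPres R C).ι.mapHomologicalComplex _).obj P.obj).ExactAt i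

/-- The category `P⁰(mod(C))`. -/
abbrev PZero : Type (max u (v + 1)) := (projRes R C).FullSubcategory

/-- The exact structure that `P⁰(mod(C))` inherits from `C⁻(mod(C))`. -/
def conflPZero : ObjectProperty (ShortComplex (PZero R C)) :=
  fun K => degreewiseSplit R C (K.map (projRes R C).ι)

variable {C} in
/-- The complex `(-, A)` concentrated in degree zero. -/
def stalk [HasZeroObject C] (A : C) : PZero R C where
  obj :=
    { obj := (HomologicalComplex.single (FPMod R C) (ComplexShape.up ℤ) 0).obj ((yonedaFP R C).obj A)
      property := ⟨0, fun i hi =>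
        HomologicalComplex.isZero_single_obj_X (ComplexShape.up ℤ) 0 _ i (by omega)⟩ }
  property := by
    have hz : ∀ i : ℤ, i ≠ 0 → IsZero (((HomologicalComplex.single (FPMod R C)
        (ComplexShape.up ℤ) 0).obj ((yonedaFP R C).obj A)).X i) := fun i hi =>
      HomologicalComplex.isZero_single_obj_X (ComplexShape.up ℤ) 0 _ i hi
    refine ⟨fun i hi => hz i (by omega), fun i => ?_, fun i hi => ?_⟩
    · by_cases h : i = 0
      · subst h
        intro K hK f
        let e := HomologicalComplex.singleObjXSelf (ComplexShape.up ℤ) (0 : ℤ) ((yonedaFP R C).obj A)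
        obtain ⟨g, hg⟩ := relProjective_yonedaFP R A K hK (e.inv ≫ f)
        exact ⟨e.hom ≫ g, by rw [Category.assoc, hg, Iso.hom_inv_id_assoc]⟩
      · intro K _ f
        exact ⟨0, (hz i h).eq_of_src _ _⟩
    · exact ShortComplex.exact_of_isZero_X₂ _ ((finPres R C).ι.map_isZero (hz i hi))

/-! ### Relative tilting subcategories of `maps(C)` -/

variable {C}

/-- `X` is `Ψ(P)`, where `Ψ` sends `⋯ ⟶ (-, A₁) ⟶ (-, A₀) ⟶ 0` to `A₁ ⟶ A₀`. Since `A ↦ (-, A)`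
identifies `C` with the projective objects of `mod(C)`, this determines `X` up to isomorphism. -/
def IsPsi [HasZeroObject C] (P : PZero R C) (X : Arrow C) : Prop :=
  Nonempty (Arrow.mk (P.obj.obj.d (-1) 0) ≅ Arrow.mk ((yonedaFP R C).map X.hom))

/-- The `P` in `P⁰(mod(C))` with `Ψ(P)` in `T`. -/
def psiPreimage [HasZeroObject C] (T : ObjectProperty (Arrow C)) : ObjectProperty (PZero R C) :=
  fun P => ∃ X, T X ∧ IsPsi R P X

/-- A full subcategory of `maps(C)`, given by its class of objects `T`, is relative tilting. -/
structure IsRelTilting [HasZeroObject C] (T : ObjectProperty (Arrow C)) : Prop where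
  rpdim : ∀ P, psiPreimage R T P → ∃ n, RelProjDimLE (conflPZero R C) n P
  ext : ∀ P Q, psiPreimage R T P → psiPreimage R T Q → ∀ k,
    ExtSuccVanishes (degreewiseSplit R C) k P.obj Q.obj
  cores : ∀ A : C, ∃ n, HasCoresolution (conflPZero R C) (psiPreimage R T) n (stalk R A)

end Functors

section Homotopy

variable {C : Type u} [Category.{v} C] [Preadditive C]

/-- Two maps `(h₁, h₀)`, `(h₁', h₀')` from `f` to `g : B₁ ⟶ B₀` in `maps(C)` are homotopic:
`h₀ - h₀'` factors through `g`. -/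
def MapsHomotopic {X Y : Arrow C} (h h' : X ⟶ Y) : Prop :=
  ∃ s : X.right ⟶ Y.left, h.right - h'.right = s ≫ Y.hom

/-- `T` is closed under isomorphism in the category of maps modulo homotopy. -/
def HomotopyClosed (T : ObjectProperty (Arrow C)) : Prop :=
  ∀ (X Y : Arrow C) (a : X ⟶ Y) (b : Y ⟶ X), MapsHomotopic (a ≫ b) (𝟙 X) →
    MapsHomotopic (b ≫ a) (𝟙 Y) → T X → T Y

end Homotopy

/-! ### Dualizing Krull-Schmidt varieties -/

/-- The injection `i : M ⟶ I` is an injective envelope. -/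
structure IsInjectiveEnvelope {R : Type v} [CommRing R] {M I : Type v} [AddCommGroup M]
    [Module R M] [AddCommGroup I] [Module R I] (i : M →ₗ[R] I) : Prop where
  injectiveModule : Module.Injective R I
  injective : Function.Injective i
  essential : ∀ N : Submodule R I, N ⊓ LinearMap.range i = ⊥ → N = ⊥

section Dualizing

variable (R : Type v) [CommRing R] (C : Type u) [Category.{v} C] [Preadditive C] [Linear R C]

instance linearOpposite : Linear R Cᵒᵖ where
  homModule X Y :=
    { smul := fun r f => (r • f.unop).op
      one_smul := fun f => Quiver.Hom.unop_inj (one_smul R f.unop)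
      mul_smul := fun r s f => Quiver.Hom.unop_inj (mul_smul r s f.unop)
      smul_zero := fun r => Quiver.Hom.unop_inj (smul_zero (A := Y.unop ⟶ X.unop) r)
      smul_add := fun r f g => Quiver.Hom.unop_inj (smul_add r f.unop g.unop)
      add_smul := fun r s f => Quiver.Hom.unop_inj (add_smul r s f.unop)
      zero_smul := fun f => Quiver.Hom.unop_inj (zero_smul R f.unop) }
  smul_comp _ _ _ r f g := Quiver.Hom.unop_inj (Linear.comp_smul _ _ _ g.unop r f.unop)
  comp_smul _ _ _ f r g := Quiver.Hom.unop_inj (Linear.smul_comp _ _ _ r g.unop f.unop)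

/-- The contravariant functor `D`, `D(M)(A) = Hom_R(M(A), I)`, from contravariant functors on `C`
to contravariant functors on `Cᵒᵖ`. -/
def dual (I : Type v) [AddCommGroup I] [Module R I] :
    (Cᵒᵖ ⥤ ModuleCat.{v} R)ᵒᵖ ⥤ (Cᵒᵖᵒᵖ ⥤ ModuleCat.{v} R) :=
  Functor.opHom _ _ ⋙
    (Functor.whiskeringRight _ _ _).obj ((linearYoneda R (ModuleCat.{v} R)).obj (ModuleCat.of R I))

/-- The `R`-variety `C` is Hom-finite, and `D` restricts to a duality between `mod(C)` and
`mod(Cᵒᵖ)`. Here `I` is meant to be the injective envelope of `R` modulo its radical. -/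
structure IsDualizing (I : Type v) [AddCommGroup I] [Module R I] : Prop where
  homFinite : ∀ A B : C, Module.Finite R (A ⟶ B)
  duality : ∃ h : ∀ M : (FPMod R C)ᵒᵖ, finPres R Cᵒᵖ (((finPres R C).ι.op ⋙ dual R C I).obj M),
    ((finPres R Cᵒᵖ).lift ((finPres R C).ι.op ⋙ dual R C I) h).IsEquivalence

end Dualizing

/-- Every object is a finite direct sum of objects with local endomorphism ring. -/
def IsKrullSchmidt (C : Type u) [Category.{v} C] [Preadditive C] [HasFiniteBiproducts C] : Prop :=
  ∀ A : C, ∃ (n : ℕ) (X : Fin n → C), Nonempty (A ≅ ⨁ X) ∧ ∀ j, IsLocalRing (End (X j))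

end MapsTilting

end

open MapsTilting

noncomputable section

open CochainComplex HomComplex

namespace MapsTilting

/-! ### Projective resolutions and cohomology of the Hom complex -/

section ProjectiveComplexes

variable {A : Type u} [Category.{v} A] [Abelian A]

/-! A complex `P` in `P⁰(mod(C))` resolves the cokernel `resolved P` of its last differential, and
this cokernel is `Φ(Ψ(P))` (`IsPsi.exists_iso`). Both notions of tilting are compared along `P ↦
resolved P`.

This functor sends conflations to short exact sequences (`DegSplit.shortExact_resolved`).
Conversely, the horseshoe lemma `exists_degSplit_of_shortExact` lifts a short exact sequence, with
any given resolutions of its ends, to a conflation. Hence relative projectives correspond to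
projectives, and the two projective dimensions agree.

For `Ext`, cones of identities are relatively projective in `C⁻(mod(C))`, so `Ext^(k+1)(P, Q)` is
`H^(k+1)(Hom(P, Q))`. Since `P` is K-projective and `Q ⟶ resolved Q` is a quasi-isomorphism, this is
the cohomology of `Hom(P, resolved Q)`, that is, `Ext^(k+1)(resolved P, resolved Q)` in `mod(C)`.

The duality supplies kernels in `mod(C)`, which is therefore an exactly embedded abelian subcategory
of all functors. Finally, `Φ` is full, and maps with the same image under `Φ` are homotopic. So a
homotopy closed `T` contains every map whose image lies in `Φ(T)`; this puts the terms of a lifted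
coresolution back into `T` and gives the converse in (b). -/

/-- `P` is a complex `⋯ ⟶ P₁ ⟶ P₀ ⟶ 0` of projectives with homology only in degree `0`. -/
structure IsProjRes (P : CochainComplex A ℤ) : Prop where
  isZero : ∀ i : ℤ, 0 < i → IsZero (P.X i)
  projective : ∀ i : ℤ, Projective (P.X i)
  exactAt : ∀ i : ℤ, i ≠ 0 → P.ExactAt i

/-- The object resolved by a projective resolution. -/
abbrev resolved (P : CochainComplex A ℤ) : A := P.opcycles 0

lemma IsProjRes.isKProjective {P : CochainComplex A ℤ} (hP : IsProjRes P) : P.IsKProjective := by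
  have : P.IsStrictlyLE 0 := by
    rw [CochainComplex.isStrictlyLE_iff]
    exact fun i hi => hP.isZero i hi
  have := hP.projective
  exact isKProjective_of_projective P 0

lemma IsProjRes.d_eq_zero {P : CochainComplex A ℤ} (hP : IsProjRes P) (j : ℤ) : P.d 0 j = 0 := by
  by_cases h : 0 + 1 = j
  · exact (hP.isZero j (by omega)).eq_of_tgt _ _
  · exact P.shape _ _ h

lemma IsProjRes.isIso_homologyι {P : CochainComplex A ℤ} (hP : IsProjRes P) :
    IsIso (P.homologyι 0) :=
  P.isIso_homologyι 0 1 (by simp) (hP.d_eq_zero 1)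

/-- The augmentation of a complex onto its degree zero opcycles. -/
def augmentation (P : CochainComplex A ℤ) :
    P ⟶ (HomologicalComplex.single A (.up ℤ) 0).obj (resolved P) :=
  HomologicalComplex.mkHomToSingle (P.pOpcycles 0) (fun i _ => by simp)

lemma augmentation_f (P : CochainComplex A ℤ) : (augmentation P).f 0 =
    P.pOpcycles 0 ≫ (HomologicalComplex.singleObjXSelf (.up ℤ) 0 (resolved P)).inv := by
  simp [augmentation]

lemma IsProjRes.quasiIso_augmentation {P : CochainComplex A ℤ} (hP : IsProjRes P) :
    QuasiIso (augmentation P) := by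
  refine ⟨fun i => ?_⟩
  by_cases hi : i = 0
  · subst hi
    rw [quasiIsoAt_iff_isIso_homologyMap]
    let S := (HomologicalComplex.single A (.up ℤ) 0).obj (resolved P)
    have h1 : IsIso (S.homologyι 0) := S.isIso_homologyι 0 1 (by simp) (by simp [S])
    have h2 : IsIso (S.pOpcycles 0) := S.isIso_pOpcycles (-1) 0 (by simp) (by simp [S])
    have h3 := hP.isIso_homologyι
    have h4 : HomologicalComplex.opcyclesMap (augmentation P) 0 =
        (HomologicalComplex.singleObjXSelf (.up ℤ) 0 (resolved P)).inv ≫ S.pOpcycles 0 := by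
      rw [← cancel_epi (P.pOpcycles 0), HomologicalComplex.p_opcyclesMap, augmentation_f,
        Category.assoc]
    have h6 : IsIso (HomologicalComplex.opcyclesMap (augmentation P) 0) := by
      rw [h4]
      exact IsIso.comp_isIso
    have h5 : HomologicalComplex.homologyMap (augmentation P) 0 ≫ S.homologyι 0 =
        P.homologyι 0 ≫ HomologicalComplex.opcyclesMap (augmentation P) 0 :=
      HomologicalComplex.homologyι_naturality _ _
    have h7 : IsIso (HomologicalComplex.homologyMap (augmentation P) 0 ≫ S.homologyι 0) := by
      rw [h5]
      exact IsIso.comp_isIso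
    exact IsIso.of_isIso_comp_right _ (S.homologyι 0)
  · rw [quasiIsoAt_iff_exactAt' _ _ (HomologicalComplex.exactAt_single_obj _ _ _ _ hi)]
    exact hP.exactAt i hi

attribute [local instance] HasDerivedCategory.standard in
/-- Postcomposition with a quasi-isomorphism is bijective on homotopy classes of maps out of a
K-projective complex. -/
lemma bijective_comp_quotient_map (P : CochainComplex A ℤ) [P.IsKProjective]
    {Y Y' : CochainComplex A ℤ} (φ : Y ⟶ Y') [QuasiIso φ] :
    Function.Bijective (fun f : (HomotopyCategory.quotient A (.up ℤ)).obj P ⟶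
      (HomotopyCategory.quotient A (.up ℤ)).obj Y =>
      f ≫ (HomotopyCategory.quotient A (.up ℤ)).map φ) := by
  have h1 := IsKProjective.Qh_map_bijective P ((HomotopyCategory.quotient A (.up ℤ)).obj Y)
  have h2 := IsKProjective.Qh_map_bijective P ((HomotopyCategory.quotient A (.up ℤ)).obj Y')
  have h3 : IsIso (DerivedCategory.Qh.map ((HomotopyCategory.quotient A (.up ℤ)).map φ)) :=
    inferInstanceAs (IsIso (DerivedCategory.Q.map φ))
  -- Bijectivity may be tested in the derived category, where `φ` becomes invertible.
  rw [← Function.Bijective.of_comp_iff' h2]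
  have : (DerivedCategory.Qh.map ∘ fun f : (HomotopyCategory.quotient A (.up ℤ)).obj P ⟶
      (HomotopyCategory.quotient A (.up ℤ)).obj Y =>
      f ≫ (HomotopyCategory.quotient A (.up ℤ)).map φ) =
      (fun g => g ≫ DerivedCategory.Qh.map ((HomotopyCategory.quotient A (.up ℤ)).map φ)) ∘
        DerivedCategory.Qh.map := by
    ext f
    simp
  rw [this]
  refine Function.Bijective.comp ⟨fun a b hab => ?_, fun a => ?_⟩ h1
  · exact (cancel_mono _).1 hab
  · exact ⟨a ≫ inv (DerivedCategory.Qh.map ((HomotopyCategory.quotient A (.up ℤ)).map φ)),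
      by simp⟩

lemma toHom_mk_postcomp {P Y Y' : CochainComplex A ℤ} {n : ℤ} (z : Cocycle P Y n) (φ : Y ⟶ Y') :
    (CohomologyClass.mk (z.postcomp φ)).toHom = (CohomologyClass.mk z).toHom ≫
      (HomotopyCategory.quotient A (.up ℤ)).map (φ⟦n⟧') := by
  rw [CohomologyClass.toHom_mk, Cocycle.equivHomShift_symm_postcomp, Functor.map_comp,
    CohomologyClass.toHom_mk]

/-- A cocycle of degree `n` is a morphism `P ⟶ Y⟦n⟧`, and a coboundary is a null-homotopic one. So
this is the injective half of `bijective_comp_quotient_map` for `φ⟦n⟧'`; the lemma after it is the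
surjective half. -/
lemma mem_coboundaries_iff_postcomp (P : CochainComplex A ℤ) [P.IsKProjective]
    {Y Y' : CochainComplex A ℤ} (φ : Y ⟶ Y') [QuasiIso φ] {n : ℤ} (z : Cocycle P Y n) :
    z ∈ coboundaries P Y n ↔ z.postcomp φ ∈ coboundaries P Y' n := by
  have h := (bijective_comp_quotient_map P (φ⟦n⟧')).injective
  rw [← CohomologyClass.toHom_mk_eq_zero_iff, ← CohomologyClass.toHom_mk_eq_zero_iff,
    toHom_mk_postcomp]
  exact ⟨fun h0 => by simp [h0], fun h0 => h (by simpa using h0)⟩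

lemma exists_postcomp_sub_mem_coboundaries (P : CochainComplex A ℤ) [P.IsKProjective]
    {Y Y' : CochainComplex A ℤ} (φ : Y ⟶ Y') [QuasiIso φ] {n : ℤ} (z' : Cocycle P Y' n) :
    ∃ z : Cocycle P Y n, z.postcomp φ - z' ∈ coboundaries P Y' n := by
  obtain ⟨f, hf⟩ := (bijective_comp_quotient_map P (φ⟦n⟧')).surjective (CohomologyClass.mk z').toHom
  obtain ⟨x, hx⟩ := (CohomologyClass.toHom_bijective P Y n).surjective f
  obtain ⟨z, rfl⟩ := CohomologyClass.mk_surjective x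
  refine ⟨z, ?_⟩
  rw [← CohomologyClass.toHom_mk_eq_zero_iff, CohomologyClass.mk_sub, map_sub, toHom_mk_postcomp,
    hx, sub_eq_zero]
  exact hf

/-- The `n`-th cohomology of `Hom(P, Q)` vanishes. -/
def HomVanishes {A : Type u} [Category.{v} A] [Preadditive A] (P Q : CochainComplex A ℤ) (n : ℤ) :
    Prop :=
  ∀ z : Cocycle P Q n, z ∈ coboundaries P Q n

lemma homVanishes_iff_of_quasiIso (P : CochainComplex A ℤ) [P.IsKProjective]
    {Y Y' : CochainComplex A ℤ} (φ : Y ⟶ Y') [QuasiIso φ] (n : ℤ) :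
    HomVanishes P Y n ↔ HomVanishes P Y' n := by
  refine ⟨fun h z' => ?_, fun h z => (mem_coboundaries_iff_postcomp P φ z).2 (h _)⟩
  obtain ⟨z, hz⟩ := exists_postcomp_sub_mem_coboundaries P φ z'
  have h1 := (mem_coboundaries_iff_postcomp P φ z).1 (h z)
  simpa using (coboundaries P Y' n).sub_mem h1 hz

/-- A cochain into a complex concentrated in degree `0` has one component, on `P.X p₁` with `p₁ =
-n`. -/
lemma homVanishes_single_iff (P : CochainComplex A ℤ) (N : A) (n : ℤ) (p₀ p₁ p₂ : ℤ)
    (h₁ : p₁ + n = 0) (h₀ : p₀ + 1 = p₁) (h₂ : p₁ + 1 = p₂) :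
    HomVanishes P ((singleFunctor A 0).obj N) n ↔
      ∀ f : P.X p₁ ⟶ N, P.d p₀ p₁ ≫ f = 0 → ∃ g : P.X p₂ ⟶ N, P.d p₁ p₂ ≫ g = f := by
  refine ⟨fun h f hf => ?_, fun h z => ?_⟩
  · exact (Cocycle.toSingleMk_mem_coboundaries_iff f h₁ p₀ h₀ hf p₂ h₂).1 (h _)
  · obtain ⟨f, hf, rfl⟩ := Cocycle.toSingleMk_surjective z p₁ h₁ p₀ h₀
    exact (Cocycle.toSingleMk_mem_coboundaries_iff f h₁ p₀ h₀ hf p₂ h₂).2 (h f hf)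

lemma IsProjRes.homVanishes_iff {P Q : CochainComplex A ℤ} (hP : IsProjRes P) (hQ : IsProjRes Q)
    (n : ℤ) (p₀ p₁ p₂ : ℤ) (h₁ : p₁ + n = 0) (h₀ : p₀ + 1 = p₁) (h₂ : p₁ + 1 = p₂) :
    HomVanishes P Q n ↔ ∀ f : P.X p₁ ⟶ resolved Q, P.d p₀ p₁ ≫ f = 0 →
      ∃ g : P.X p₂ ⟶ resolved Q, P.d p₁ p₂ ≫ g = f := by
  have := hP.isKProjective
  have := hQ.quasiIso_augmentation
  rw [homVanishes_iff_of_quasiIso P (augmentation Q)]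
  exact homVanishes_single_iff P _ n p₀ p₁ p₂ h₁ h₀ h₂

/-! ### Degreewise split sequences -/

/-- The sequence of complexes splits in every degree. -/
def DegSplit {A : Type u} [Category.{v} A] [Preadditive A]
    (S : ShortComplex (CochainComplex A ℤ)) : Prop :=
  ∃ (r : ∀ i, S.X₂.X i ⟶ S.X₁.X i) (s : ∀ i, S.X₃.X i ⟶ S.X₂.X i), ∀ i,
    S.f.f i ≫ r i = 𝟙 _ ∧ s i ≫ S.g.f i = 𝟙 _ ∧ r i ≫ S.f.f i + S.g.f i ≫ s i = 𝟙 _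

lemma degSplit_iff {A : Type u} [Category.{v} A] [Preadditive A]
    {S : ShortComplex (CochainComplex A ℤ)} :
    DegSplit S ↔ ∀ i : ℤ, Nonempty (S.map (HomologicalComplex.eval A (.up ℤ) i)).Splitting := by
  refine ⟨?_, fun h => ?_⟩
  · rintro ⟨r, s, h⟩ i
    exact ⟨⟨r i, s i, (h i).1, (h i).2.1, (h i).2.2⟩⟩
  · exact ⟨fun i => (h i).some.r, fun i => (h i).some.s, fun i =>
      ⟨(h i).some.f_r, (h i).some.s_g, (h i).some.id⟩⟩

lemma DegSplit.shortExact {S : ShortComplex (CochainComplex A ℤ)} (hS : DegSplit S) :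
    S.ShortExact :=
  HomologicalComplex.shortExact_of_degreewise_shortExact S fun i =>
    (degSplit_iff.1 hS i).some.shortExact

/-- Lifting along a degreewise split epimorphism with kernel `K` is possible
if `H¹(Hom(L, K)) = 0`. -/
lemma DegSplit.exists_lift {A : Type u} [Category.{v} A] [Preadditive A]
    {S : ShortComplex (CochainComplex A ℤ)} (hS : DegSplit S)
    {L : CochainComplex A ℤ} (hL : HomVanishes L S.X₁ 1) (f : L ⟶ S.X₃) :
    ∃ g : L ⟶ S.X₂, g ≫ S.g = f := by
  obtain ⟨r, s, h⟩ := hS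
  -- `θ` is the class of the extension and measures how far `s` is from a chain map (`hs`). By
  -- hypothesis its pullback along `f` is some `δ β`, so subtracting `β` turns the degreewise lift
  -- `f ≫ s` into a chain map.
  let θ : Cocycle S.X₃ S.X₁ 1 := cocycleOfDegreewiseSplit S
    fun i => ⟨r i, s i, (h i).1, (h i).2.1, (h i).2.2⟩
  have hθ (p q : ℤ) (hpq : p + 1 = q) : θ.1.v p q hpq = s p ≫ S.X₂.d p q ≫ r q := rfl
  obtain ⟨β, hβ⟩ := (mem_coboundaries_iff (θ.precomp f) 0 (by simp)).1 (hL _)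
  have hβ' : δ 0 1 β = (Cochain.ofHom f).comp θ.1 (zero_add 1) := hβ
  have hs : δ 0 1 (Cochain.ofHoms s) = θ.1.comp (Cochain.ofHom S.f) (add_zero 1) := by
    ext p q hpq
    have h1 : S.X₂.d p q ≫ r q ≫ S.f.f q = S.X₂.d p q - S.X₂.d p q ≫ S.g.f q ≫ s q := by
      rw [eq_sub_iff_add_eq, ← Preadditive.comp_add, (h q).2.2, Category.comp_id]
    simp only [δ_zero_cochain_v, Cochain.ofHoms_v, Cochain.comp_zero_cochain_v,
      Cochain.ofHom_v, hθ, Category.assoc, h1, Preadditive.comp_sub]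
    rw [← S.g.comm_assoc, reassoc_of% (h p).2.1]
  let z : Cocycle L S.X₂ 0 := Cocycle.mk ((Cochain.ofHom f).comp (Cochain.ofHoms s) (zero_add 0) -
    β.comp (Cochain.ofHom S.f) (add_zero 0)) 1 (by simp) (by
      rw [δ_sub, δ_comp_ofHom, δ_ofHom_comp, hβ', hs, Cochain.comp_assoc_of_third_is_zero_cochain,
        sub_self])
  have hz (i : ℤ) : z.1.v i i (add_zero i) = f.f i ≫ s i - β.v i i (add_zero i) ≫ S.f.f i := by
    simp only [z, Cocycle.mk, Cochain.sub_v, Cochain.comp_zero_cochain_v, Cochain.ofHom_v,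
      Cochain.ofHoms_v]
  refine ⟨Cocycle.homOf z, ?_⟩
  ext i
  have h3 : S.f.f i ≫ S.g.f i = 0 := by rw [← HomologicalComplex.comp_f, S.zero]; rfl
  rw [HomologicalComplex.comp_f, Cocycle.homOf_f, hz, Preadditive.sub_comp, Category.assoc,
    Category.assoc, h3, (h i).2.1, comp_zero, sub_zero, Category.comp_id]

end ProjectiveComplexes

/-! ### Independence of relative `Ext` from the resolution -/

section RelativeExt

variable {E : Type w} [Category.{w'} E] [Preadditive E]

/-- Every sequence in `S` is a kernel-cokernel pair. -/
structure KernelCokernelPairs (S : ObjectProperty (ShortComplex E)) : Prop where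
  mono : ∀ K, S K → Mono K.f
  epi : ∀ K, S K → Epi K.g
  lift : ∀ K, S K → ∀ (W : E) (t : W ⟶ K.X₂), t ≫ K.g = 0 → ∃ u, u ≫ K.f = t
  desc : ∀ K, S K → ∀ (W : E) (t : K.X₂ ⟶ W), K.f ≫ t = 0 → ∃ u, K.g ≫ u = t

variable {S : ObjectProperty (ShortComplex E)} {X Y : E}

/-- A map killed by `Q.d (k + 1)` factors uniquely through the cokernel `Q.quot (k + 1)`, so
vanishing of `Ext` becomes an extension property along `Q.incl k`. -/
lemma RelResolution.exact_hom_iff (hS : KernelCokernelPairs S) (Q : RelResolution S X) (k : ℕ) :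
    (∀ f : Q.proj (k + 1) ⟶ Y, Q.d (k + 1) ≫ f = 0 → ∃ g : Q.proj k ⟶ Y, Q.d k ≫ g = f) ↔
      ∀ f : Q.syz (k + 1) ⟶ Y, ∃ g : Q.proj k ⟶ Y, Q.incl k ≫ g = f := by
  have hepi (j : ℕ) : Epi (Q.quot j) := hS.epi _ (Q.conflation j)
  constructor
  · intro h f
    obtain ⟨g, hg⟩ := h (Q.quot (k + 1) ≫ f) (by
      rw [RelResolution.d, Category.assoc, ← Category.assoc (Q.incl _), Q.zero, zero_comp,
        comp_zero])
    refine ⟨g, ?_⟩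
    rwa [RelResolution.d, Category.assoc, cancel_epi] at hg
  · intro h f hf
    rw [RelResolution.d, Category.assoc, ← comp_zero (f := Q.quot (k + 1 + 1)), cancel_epi] at hf
    obtain ⟨u, hu⟩ := hS.desc _ (Q.conflation (k + 1)) _ f hf
    obtain ⟨g, hg⟩ := h u
    refine ⟨g, ?_⟩
    rw [RelResolution.d, Category.assoc, hg]
    exact hu

/-- Dimension shift for the invariant "`ψ ≫ φ` is the identity up to a map through a relative
projective". One-sided control is enough for transferring the extension property, and no biproducts
are needed as in Schanuel's lemma. -/
lemma RelResolution.exists_comparison_step (hS : KernelCokernelPairs S) {X' : E}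
    (Q : RelResolution S X) (Q' : RelResolution S X') (k : ℕ) (φ : Q.syz k ⟶ Q'.syz k)
    (ψ : Q'.syz k ⟶ Q.syz k) (s : Q'.syz k ⟶ Q'.proj k) (hs : s ≫ Q'.quot k = ψ ≫ φ - 𝟙 _) :
    ∃ (φ' : Q.syz (k + 1) ⟶ Q'.syz (k + 1)) (ψ' : Q'.syz (k + 1) ⟶ Q.syz (k + 1))
      (Ψ : Q'.proj k ⟶ Q.proj k) (m : Q'.proj k ⟶ Q'.syz (k + 1)),
      ψ' ≫ Q.incl k = Q'.incl k ≫ Ψ ∧ Q'.incl k ≫ m = ψ' ≫ φ' - 𝟙 _ := by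
  obtain ⟨Φ, hΦ : Φ ≫ Q'.quot k = _⟩ := Q.projective k _ (Q'.conflation k) (Q.quot k ≫ φ)
  obtain ⟨Ψ, hΨ : Ψ ≫ Q.quot k = _⟩ := Q'.projective k _ (Q.conflation k) (Q'.quot k ≫ ψ)
  have hm : Mono (Q'.incl k) := hS.mono _ (Q'.conflation k)
  obtain ⟨φ', hφ' : φ' ≫ Q'.incl k = _⟩ :=
    hS.lift _ (Q'.conflation k) _ (Q.incl k ≫ Φ) (by
      dsimp only; rw [Category.assoc, hΦ, ← Category.assoc, Q.zero, zero_comp])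
  obtain ⟨ψ', hψ' : ψ' ≫ Q.incl k = _⟩ :=
    hS.lift _ (Q.conflation k) _ (Q'.incl k ≫ Ψ) (by
      dsimp only; rw [Category.assoc, hΨ, ← Category.assoc, Q'.zero, zero_comp])
  -- The map `Ψ ≫ Φ - 𝟙` need not land in the kernel of `Q'.quot k`; the correction by `s` makes it
  -- do so, and this correction vanishes on `Q'.incl k`.
  obtain ⟨m, hm' : m ≫ Q'.incl k = _⟩ :=
    hS.lift _ (Q'.conflation k) _ (Ψ ≫ Φ - 𝟙 _ - Q'.quot k ≫ s) (by
      dsimp only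
      simp only [Preadditive.sub_comp, Category.assoc, hΦ, hs, reassoc_of% hΨ, Category.id_comp,
        Preadditive.comp_sub, Category.comp_id]
      abel)
  refine ⟨φ', ψ', Ψ, m, hψ', ?_⟩
  rw [← cancel_mono (Q'.incl k), Category.assoc, hm', Preadditive.sub_comp,
    Category.assoc, hφ', reassoc_of% hψ', Preadditive.comp_sub, Preadditive.comp_sub,
    ← Category.assoc (Q'.incl k) (Q'.quot k), Q'.zero]
  simp

lemma RelResolution.exists_comparison (hS : KernelCokernelPairs S) (Q Q' : RelResolution S X)
    (k : ℕ) : ∃ (φ : Q.syz k ⟶ Q'.syz k) (ψ : Q'.syz k ⟶ Q.syz k) (s : Q'.syz k ⟶ Q'.proj k),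
      s ≫ Q'.quot k = ψ ≫ φ - 𝟙 _ := by
  induction k with
  | zero =>
    exact ⟨Q.syzZeroIso.hom ≫ Q'.syzZeroIso.inv, Q'.syzZeroIso.hom ≫ Q.syzZeroIso.inv, 0, by simp⟩
  | succ k ih =>
    obtain ⟨φ, ψ, s, hs⟩ := ih
    obtain ⟨φ', ψ', Ψ, m, -, hm⟩ := exists_comparison_step hS Q Q' k φ ψ s hs
    -- The source of `m` is relatively projective, so `m` lifts to the next term; this restores the
    -- invariant.
    obtain ⟨n, hn : n ≫ Q'.quot (k + 1) = m⟩ := Q'.projective k _ (Q'.conflation (k + 1)) m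
    exact ⟨φ', ψ', Q'.incl k ≫ n, by rw [Category.assoc, hn, hm]⟩

lemma RelResolution.extends_of_extends (hS : KernelCokernelPairs S) (Q Q' : RelResolution S X)
    (k : ℕ) (h : ∀ f : Q.syz (k + 1) ⟶ Y, ∃ g : Q.proj k ⟶ Y, Q.incl k ≫ g = f)
    (f : Q'.syz (k + 1) ⟶ Y) : ∃ g : Q'.proj k ⟶ Y, Q'.incl k ≫ g = f := by
  obtain ⟨φ, ψ, s, hs⟩ := Q.exists_comparison hS Q' k
  obtain ⟨φ', ψ', Ψ, m, hψ', hm⟩ := exists_comparison_step hS Q Q' k φ ψ s hs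
  obtain ⟨g, hg⟩ := h (φ' ≫ f)
  -- `Ψ ≫ g` extends `ψ' ≫ φ' ≫ f`, and `m ≫ f` extends its difference from `f`.
  refine ⟨Ψ ≫ g - m ≫ f, ?_⟩
  rw [Preadditive.comp_sub, ← reassoc_of% hψ', hg, ← Category.assoc (Q'.incl k) m, hm,
    Preadditive.sub_comp]
  simp

/-- `Ext` can be computed with any resolution. -/
lemma RelResolution.extSuccVanishes_iff (hS : KernelCokernelPairs S) (Q : RelResolution S X)
    (k : ℕ) : ExtSuccVanishes S k X Y ↔
      ∀ f : Q.syz (k + 1) ⟶ Y, ∃ g : Q.proj k ⟶ Y, Q.incl k ≫ g = f := by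
  refine ⟨?_, fun h => ⟨Q, (Q.exact_hom_iff hS k).2 h⟩⟩
  rintro ⟨Q', hQ'⟩
  exact Q'.extends_of_extends hS Q k ((Q'.exact_hom_iff hS k).1 hQ')

lemma RelResolution.extSuccVanishes_iff' (hS : KernelCokernelPairs S) (Q : RelResolution S X)
    (k : ℕ) : ExtSuccVanishes S k X Y ↔
      ∀ f : Q.proj (k + 1) ⟶ Y, Q.d (k + 1) ≫ f = 0 → ∃ g : Q.proj k ⟶ Y, Q.d k ≫ g = f := by
  rw [Q.extSuccVanishes_iff hS, Q.exact_hom_iff hS]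

lemma ExtSuccVanishes.of_iso {k : ℕ} {X' Y' : E} (h : ExtSuccVanishes S k X Y) (e : X ≅ X')
    (e' : Y ≅ Y') : ExtSuccVanishes S k X' Y' := by
  obtain ⟨Q, hQ⟩ := h
  refine ⟨{ Q with syzZeroIso := Q.syzZeroIso ≪≫ e }, fun f hf => ?_⟩
  obtain ⟨g, hg⟩ := hQ (f ≫ e'.inv) (by
    have hf' : Q.d (k + 1) ≫ f = 0 := hf
    rw [← Category.assoc, hf', zero_comp])
  refine ⟨g ≫ e'.hom, ?_⟩
  have : (Q.d k ≫ g) ≫ e'.hom = f := by rw [hg]; simp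
  rwa [Category.assoc] at this

lemma RelProjective.of_iso {P P' : E} (h : RelProjective S P) (e : P ≅ P') :
    RelProjective S P' := fun K hK f => by
  obtain ⟨g, hg⟩ := h K hK (e.hom ≫ f)
  exact ⟨e.inv ≫ g, by rw [Category.assoc, hg, Iso.inv_hom_id_assoc]⟩

lemma RelProjDimLE.of_iso {n : ℕ} {X' : E} (h : RelProjDimLE S n X) (e : X ≅ X') :
    RelProjDimLE S n X' := by
  cases n with
  | zero => exact RelProjective.of_iso h e
  | succ n =>
    obtain ⟨K, hK, ⟨e'⟩, h2, h1⟩ := h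
    exact ⟨K, hK, ⟨e' ≪≫ e⟩, h2, h1⟩

end RelativeExt

/-! ### Syzygies, extensions of resolutions and the horseshoe lemma -/

section ProjectiveComplexes

variable {A : Type u} [Category.{v} A] [Abelian A]

/-- Opcycles play the role of syzygies: the kernel of `P.fromOpcycles i j` is the homology at `i`,
which vanishes, and its image is that of `P.d i j` because `P.pOpcycles i` is epi. -/
lemma shortExact_fromOpcycles (P : CochainComplex A ℤ) (i j : ℤ) (hij : i + 1 = j)
    (hi : P.ExactAt i) :
    (ShortComplex.mk (P.fromOpcycles i j) (P.pOpcycles j) (by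
      rw [← cancel_epi (P.pOpcycles i)]; simp)).ShortExact where
  exact := by
    have h0 : (ShortComplex.mk (P.d i j) (P.pOpcycles j) (by simp)).Exact :=
      ShortComplex.exact_of_g_is_cokernel _ (P.opcyclesIsCokernel i j (by simp [← hij]))
    let φ : ShortComplex.mk (P.d i j) (P.pOpcycles j) (by simp) ⟶
        ShortComplex.mk (P.fromOpcycles i j) (P.pOpcycles j) (by
          rw [← cancel_epi (P.pOpcycles i)]; simp) :=
      { τ₁ := P.pOpcycles i, τ₂ := 𝟙 _, τ₃ := 𝟙 _ }
    exact (ShortComplex.exact_iff_of_epi_of_isIso_of_mono φ).1 h0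
  mono_f := by
    have h := P.homologyIsKernel i j (by simp [← hij])
    have hz := hi.isZero_homology
    refine Preadditive.mono_of_cancel_zero _ fun g hg => ?_
    rw [← KernelFork.IsLimit.lift' h g hg |>.2]
    rw [hz.eq_of_tgt (KernelFork.IsLimit.lift' h g hg).1 0, zero_comp]
  epi_g := by dsimp; infer_instance

/-- Opcycles are right exact. Injectivity on the left comes from the long exact sequence, as the
homology of `S.X₃` in degree `-1` is zero and opcycles agree with homology in degree `0`. -/
lemma DegSplit.shortExact_resolved {S : ShortComplex (CochainComplex A ℤ)} (hS : DegSplit S)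
    (h₁ : IsProjRes S.X₁) (h₂ : IsProjRes S.X₂) (h₃ : IsProjRes S.X₃) :
    (ShortComplex.mk (HomologicalComplex.opcyclesMap S.f 0) (HomologicalComplex.opcyclesMap S.g 0)
      (by rw [← HomologicalComplex.opcyclesMap_comp, S.zero,
        HomologicalComplex.opcyclesMap_zero])).ShortExact := by
  have hS' := hS.shortExact
  have := hS'.epi_g
  have i1 := h₁.isIso_homologyι
  have i2 := h₂.isIso_homologyι
  have hm : Mono (HomologicalComplex.homologyMap S.f 0) := by
    have := hS'.homology_exact₁ (-1) 0 (by simp)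
    rw [ShortComplex.exact_iff_mono] at this
    · exact this
    · exact (h₃.exactAt (-1) (by simp)).isZero_homology.eq_of_src _ _
  have hm' : Mono (HomologicalComplex.opcyclesMap S.f 0) := by
    have : HomologicalComplex.opcyclesMap S.f 0 = inv (S.X₁.homologyι 0) ≫
        HomologicalComplex.homologyMap S.f 0 ≫ S.X₂.homologyι 0 := by
      rw [HomologicalComplex.homologyι_naturality, IsIso.inv_hom_id_assoc]
    rw [this]
    infer_instance
  exact
  { exact := HomologicalComplex.opcycles_right_exact S hS'.exact 0
    mono_f := hm'
    epi_g := by dsimp; infer_instance }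

lemma DegSplit.isProjRes₂ {S : ShortComplex (CochainComplex A ℤ)} (hS : DegSplit S)
    (h₁ : IsProjRes S.X₁) (h₃ : IsProjRes S.X₃) : IsProjRes S.X₂ where
  isZero i hi := by
    obtain ⟨r, s, h⟩ := hS
    rw [IsZero.iff_id_eq_zero, ← (h i).2.2, (h₁.isZero i hi).eq_of_tgt (r i) 0,
      (h₃.isZero i hi).eq_of_src (s i) 0]
    simp
  projective i := by
    have := h₁.projective i
    have := h₃.projective i
    have e := (degSplit_iff.1 hS i).some.isoBinaryBiproduct
    exact Projective.of_iso (P := S.X₁.X i ⊞ S.X₃.X i) (Q := S.X₂.X i) e.symm inferInstance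
  exactAt i hi := hS.shortExact.exactAt_X₂ i (h₁.exactAt i hi) (h₃.exactAt i hi)

/-- The extension of `P` by `K` classified by the cocycle `θ`. -/
def twistedSum {A : Type u} [Category.{v} A] [Preadditive A] [HasBinaryBiproducts A]
    {P K : CochainComplex A ℤ} (θ : Cocycle P K 1) : CochainComplex A ℤ where
  X i := K.X i ⊞ P.X i
  d i j := biprod.map (K.d i j) (P.d i j) +
    if h : i + 1 = j then biprod.snd ≫ θ.1.v i j h ≫ biprod.inl else 0
  shape i j hij := by
    rw [K.shape _ _ hij, P.shape _ _ hij, dif_neg (show ¬ i + 1 = j from hij)]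
    ext <;> simp
  d_comp_d' i j k hij hjk := by
    obtain rfl : i + 1 = j := hij
    obtain rfl : i + 1 + 1 = k := hjk
    have h := Cochain.congr_v (θ.δ_eq_zero 2) i (i + 1 + 1) (by omega)
    rw [δ_v 1 2 rfl θ.1 i (i + 1 + 1) (by omega) (i + 1) (i + 1) (by omega) rfl] at h
    have h' : θ.1.v i (i + 1) rfl ≫ K.d (i + 1) (i + 1 + 1) +
        P.d i (i + 1) ≫ θ.1.v (i + 1) (i + 1 + 1) rfl = 0 := by
      simpa [show Int.negOnePow 2 = 1 from rfl] using h
    rw [dif_pos rfl, dif_pos rfl]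
    ext
    · simp
    · simp
    · simpa [add_comm] using h'
    · simp

/-- The inclusion of `K` into the extension. -/
def twistedSum.inl {A : Type u} [Category.{v} A] [Preadditive A] [HasBinaryBiproducts A]
    {P K : CochainComplex A ℤ} (θ : Cocycle P K 1) : K ⟶ twistedSum θ where
  f i := (biprod.inl : K.X i ⟶ K.X i ⊞ P.X i)
  comm' i j hij := by
    obtain rfl : i + 1 = j := hij
    simp [twistedSum]

/-- The projection of the extension onto `P`. -/
def twistedSum.snd {A : Type u} [Category.{v} A] [Preadditive A] [HasBinaryBiproducts A]
    {P K : CochainComplex A ℤ} (θ : Cocycle P K 1) : twistedSum θ ⟶ P where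
  f i := (biprod.snd : K.X i ⊞ P.X i ⟶ P.X i)
  comm' i j hij := by
    obtain rfl : i + 1 = j := hij
    simp [twistedSum]

lemma twistedSum.inl_snd {A : Type u} [Category.{v} A] [Preadditive A] [HasBinaryBiproducts A]
    {P K : CochainComplex A ℤ} (θ : Cocycle P K 1) : inl θ ≫ snd θ = 0 := by
  ext i
  exact biprod.inl_snd

lemma twistedSum.degSplit {A : Type u} [Category.{v} A] [Preadditive A] [HasBinaryBiproducts A]
    {P K : CochainComplex A ℤ} (θ : Cocycle P K 1) :
    DegSplit (ShortComplex.mk (inl θ) (snd θ) (inl_snd θ)) :=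
  ⟨fun _ => biprod.fst, fun _ => biprod.inr, fun _ => ⟨biprod.inl_fst, biprod.inr_snd,
    biprod.total⟩⟩

/-- A class in `Ext¹` represented by `f` lifts along the augmentation of `Q` to a genuine cocycle of
`Hom(P, Q)`. The lift is exact only up to a coboundary, which accounts for `g`. -/
lemma exists_cocycle_of_hom_resolved {P Q : CochainComplex A ℤ} (hP : IsProjRes P)
    (hQ : IsProjRes Q) (f : P.X (-1) ⟶ resolved Q) (hf : P.d (-2) (-1) ≫ f = 0) :
    ∃ (θ : Cocycle P Q 1) (g : P.X 0 ⟶ resolved Q),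
      θ.1.v (-1) 0 (by simp) ≫ Q.pOpcycles 0 = f + P.d (-1) 0 ≫ g := by
  have := hP.isKProjective
  have := hQ.quasiIso_augmentation
  let z' : Cocycle P ((HomologicalComplex.single A (.up ℤ) 0).obj (resolved Q)) 1 :=
    Cocycle.toSingleMk f (by simp) (-2) (by simp) hf
  obtain ⟨θ, hθ⟩ := exists_postcomp_sub_mem_coboundaries P (augmentation Q) z'
  obtain ⟨β, hβ⟩ := (mem_coboundaries_iff _ 0 (by simp)).1 hθ
  have h := Cochain.congr_v hβ (-1) 0 (by simp)
  have h1 : (θ.postcomp (augmentation Q) - z').1.v (-1) 0 (by simp) =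
    θ.1.v (-1) 0 (by simp) ≫ Q.pOpcycles 0 ≫
      (HomologicalComplex.singleObjXSelf (.up ℤ) 0 (resolved Q)).inv -
    f ≫ (HomologicalComplex.singleObjXSelf (.up ℤ) 0 (resolved Q)).inv := by
    rw [← augmentation_f]
    have ha : (θ.postcomp (augmentation Q)).1.v (-1) 0 (by simp) =
        θ.1.v (-1) 0 (by simp) ≫ (augmentation Q).f 0 :=
      (Cochain.comp_zero_cochain_v _ _ _ _ _).trans (congrArg _ (Cochain.ofHom_v _ _))
    have hb : z'.1.v (-1) 0 (by simp) =
        f ≫ (HomologicalComplex.singleObjXSelf (.up ℤ) 0 (resolved Q)).inv :=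
      Cochain.toSingleMk_v f _
    rw [← ha, ← hb]
    rfl
  have h2 : (δ 0 1 β).v (-1) 0 (by simp) = - (P.d (-1) 0 ≫ β.v 0 0 (by simp)) := by
    rw [δ_zero_cochain_v]
    have : ((HomologicalComplex.single A (.up ℤ) 0).obj (resolved Q)).d (-1) 0 = 0 := by simp
    rw [this, comp_zero, zero_sub]
  refine ⟨θ, - (β.v 0 0 (by simp) ≫
    (HomologicalComplex.singleObjXSelf (.up ℤ) 0 (resolved Q)).hom), ?_⟩
  have h3 := congrArg (· ≫ (HomologicalComplex.singleObjXSelf (.up ℤ) 0 (resolved Q)).hom)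
    (h1.symm.trans (h.symm.trans h2))
  simp only [Preadditive.sub_comp, Category.assoc, Iso.inv_hom_id, Category.comp_id,
    Preadditive.neg_comp] at h3
  rw [Preadditive.comp_neg, ← h3]
  abel

/-- **Horseshoe lemma**: given resolutions of the ends of a short exact sequence, the middle term
is resolved by an extension of them. -/
lemma exists_degSplit_of_shortExact {K P : CochainComplex A ℤ} (hK : IsProjRes K)
    (hP : IsProjRes P) {S : ShortComplex A} (hS : S.ShortExact) (e₁ : resolved K ≅ S.X₁)
    (e₃ : resolved P ≅ S.X₃) :
    ∃ (L : CochainComplex A ℤ) (f : K ⟶ L) (g : L ⟶ P) (w : f ≫ g = 0),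
      IsProjRes L ∧ DegSplit (ShortComplex.mk f g w) ∧ Nonempty (resolved L ≅ S.X₂) := by
  have := hS.mono_f
  have := hS.epi_g
  have := hP.projective 0
  let m : P.X 0 ⟶ S.X₂ := Projective.factorThru (P.pOpcycles 0 ≫ e₃.hom) S.g
  have hm : m ≫ S.g = P.pOpcycles 0 ≫ e₃.hom := Projective.factorThru_comp _ _
  let t : P.X (-1) ⟶ S.X₁ := hS.exact.lift (P.d (-1) 0 ≫ m) (by rw [Category.assoc, hm]; simp)
  have ht : t ≫ S.f = P.d (-1) 0 ≫ m := hS.exact.lift_f _ _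
  -- `t` represents the class of `S`. The sign makes the contributions of `θ` and of `P.d (-1) 0`
  -- cancel in `hq`, where the error term `g` is subtracted from `m`.
  obtain ⟨θ, g, hθ⟩ := exists_cocycle_of_hom_resolved hP hK (-(t ≫ e₁.inv)) (by
    rw [Preadditive.comp_neg, neg_eq_zero, ← Category.assoc]
    have : P.d (-2) (-1) ≫ t = 0 := by
      rw [← cancel_mono S.f, Category.assoc, ht]; simp
    rw [this, zero_comp])
  have hsplit := twistedSum.degSplit θ
  have hL : IsProjRes (twistedSum θ) := hsplit.isProjRes₂ hK hP
  refine ⟨twistedSum θ, twistedSum.inl θ, twistedSum.snd θ, twistedSum.inl_snd θ, hL, hsplit, ?_⟩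
  let q : (twistedSum θ).X 0 ⟶ S.X₂ :=
    biprod.desc (K.pOpcycles 0 ≫ e₁.hom ≫ S.f) (m - g ≫ e₁.hom ≫ S.f)
  have hq : (twistedSum θ).d (-1) 0 ≫ q = 0 := by
    have h1 : θ.1.v (-1) 0 (by simp) ≫ K.pOpcycles 0 ≫ e₁.hom ≫ S.f =
        - (P.d (-1) 0 ≫ m) + P.d (-1) 0 ≫ g ≫ e₁.hom ≫ S.f := by
      rw [← Category.assoc, hθ, Preadditive.add_comp, Preadditive.neg_comp, Category.assoc,
        e₁.inv_hom_id_assoc, ht, Category.assoc]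
    change (biprod.map (K.d (-1) 0) (P.d (-1) 0) + dite _ _ _) ≫ biprod.desc _ _ =
      (0 : K.X (-1) ⊞ P.X (-1) ⟶ S.X₂)
    rw [dif_pos (by simp)]
    ext
    · simp
    · simp [h1]
  let q' : resolved (twistedSum θ) ⟶ S.X₂ := (twistedSum θ).descOpcycles q (-1) (by simp) hq
  have hq' : (twistedSum θ).pOpcycles 0 ≫ q' = q := HomologicalComplex.p_descOpcycles _ _ _ _ _
  have c₁₂ : HomologicalComplex.opcyclesMap (twistedSum.inl θ) 0 ≫ q' = e₁.hom ≫ S.f := by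
    rw [← cancel_epi (K.pOpcycles 0), HomologicalComplex.p_opcyclesMap_assoc, hq']
    exact biprod.inl_desc _ _
  have c₂₃ : q' ≫ S.g = HomologicalComplex.opcyclesMap (twistedSum.snd θ) 0 ≫ e₃.hom := by
    rw [← cancel_epi ((twistedSum θ).pOpcycles 0), HomologicalComplex.p_opcyclesMap_assoc,
      reassoc_of% hq']
    change biprod.desc _ _ ≫ S.g = (biprod.snd : K.X 0 ⊞ P.X 0 ⟶ _) ≫ _
    ext
    · simp
    · simp [hm]
  let φ : ShortComplex.mk (HomologicalComplex.opcyclesMap (twistedSum.inl θ) 0)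
      (HomologicalComplex.opcyclesMap (twistedSum.snd θ) 0)
      (by rw [← HomologicalComplex.opcyclesMap_comp, twistedSum.inl_snd,
        HomologicalComplex.opcyclesMap_zero]) ⟶ S :=
    { τ₁ := e₁.hom
      τ₂ := q'
      τ₃ := e₃.hom
      comm₁₂ := c₁₂.symm
      comm₂₃ := c₂₃ }
  have : IsIso φ.τ₁ := inferInstanceAs (IsIso e₁.hom)
  have : IsIso φ.τ₃ := inferInstanceAs (IsIso e₃.hom)
  -- Five lemma: both rows are short exact and the outer maps are isomorphisms.
  have h : IsIso φ.τ₂ := ShortComplex.isIso₂_of_shortExact_of_isIso₁₃ φ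
    (hsplit.shortExact_resolved hK hL hP) hS
  exact ⟨@asIso _ _ _ _ φ.τ₂ h⟩

end ProjectiveComplexes

/-! ### `Ext` of resolved objects through the Hom complex -/

section ProjectiveComplexes

variable {A : Type u} [Category.{v} A] [Abelian A]

variable (A) in
/-- The class of all short exact sequences. -/
def shortExactSeq : ObjectProperty (ShortComplex A) := fun K => K.ShortExact

lemma kernelCokernelPairs_shortExactSeq : KernelCokernelPairs (shortExactSeq A) where
  mono _ hK := hK.mono_f
  epi _ hK := hK.epi_g
  lift _ hK W t ht := by
    have := hK.mono_f
    exact ⟨hK.exact.lift t ht, hK.exact.lift_f t ht⟩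
  desc _ hK W t ht := by
    have := hK.epi_g
    exact ⟨hK.exact.desc t ht, hK.exact.g_desc t ht⟩

lemma shortExact_kernel_ι {M N : A} (p : M ⟶ N) [Epi p] :
    (ShortComplex.mk (kernel.ι p) p (kernel.condition p)).ShortExact where
  exact := ShortComplex.exact_of_f_is_kernel _ (kernelIsKernel p)

lemma relProjective_shortExactSeq_iff (P : A) : RelProjective (shortExactSeq A) P ↔ Projective P := by
  refine ⟨fun h => ⟨fun {M N} f e he => ?_⟩, fun h K hK f => ?_⟩
  · exact h _ (shortExact_kernel_ι e) f
  · have := hK.epi_g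
    exact ⟨Projective.factorThru f K.g, Projective.factorThru_comp _ _⟩

/-- The resolution of `resolved P` given by `P`. -/
def IsProjRes.resolution {P : CochainComplex A ℤ} (hP : IsProjRes P) :
    RelResolution (shortExactSeq A) (resolved P) where
  syz k := P.opcycles (-(k : ℤ))
  proj k := P.X (-(k : ℤ))
  syzZeroIso := Iso.refl _
  incl k := P.fromOpcycles _ _
  quot k := P.pOpcycles _
  zero k := by rw [← cancel_epi (P.pOpcycles _)]; simp
  conflation k := shortExact_fromOpcycles P _ _ (by push_cast; ring) (hP.exactAt _ (by omega))
  projective k := (relProjective_shortExactSeq_iff _).2 (hP.projective _)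

lemma IsProjRes.resolution_d {P : CochainComplex A ℤ} (hP : IsProjRes P) (k : ℕ) :
    hP.resolution.d k = P.d (-((k + 1 : ℕ) : ℤ)) (-(k : ℤ)) :=
  HomologicalComplex.p_fromOpcycles _ _ _

lemma IsProjRes.extSuccVanishes_iff {P Q : CochainComplex A ℤ} (hP : IsProjRes P)
    (hQ : IsProjRes Q) (k : ℕ) :
    ExtSuccVanishes (shortExactSeq A) k (resolved P) (resolved Q) ↔ HomVanishes P Q (k + 1) := by
  rw [hP.resolution.extSuccVanishes_iff' kernelCokernelPairs_shortExactSeq,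
    hP.homVanishes_iff hQ (k + 1) (-((k + 1 + 1 : ℕ) : ℤ)) (-((k + 1 : ℕ) : ℤ)) (-(k : ℤ))
      (by push_cast; ring) (by push_cast; ring) (by push_cast; ring), hP.resolution_d,
      hP.resolution_d]
  rfl

/-- This group is `Ext¹` out of a projective object: the first syzygy sequence splits. Together with
`DegSplit.exists_lift` it makes `P` relatively projective. -/
lemma IsProjRes.homVanishes_one {P Q : CochainComplex A ℤ} (hP : IsProjRes P)
    (hQ : IsProjRes Q) (h : Projective (resolved P)) : HomVanishes P Q 1 := by
  have h0 := (hP.extSuccVanishes_iff hQ 0).1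
  refine h0 ((hP.resolution.extSuccVanishes_iff kernelCokernelPairs_shortExactSeq 0).2 fun f => ?_)
  have hs := shortExact_fromOpcycles P (-1) 0 (by simp) (hP.exactAt _ (by simp))
  have σ := hs.splittingOfProjective
  have h1 : P.fromOpcycles (-1) 0 ≫ σ.r = 𝟙 _ := σ.f_r
  refine ⟨σ.r ≫ f, ?_⟩
  exact (Category.assoc _ _ _).symm.trans ((congrArg (· ≫ f) h1).trans (Category.id_comp f))

/-! ### Existence of projective resolutions -/

section Existence

variable [EnoughProjectives A]

/-- The iterated projective covers of the kernel of `f`. -/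
def iteratedCover (f : Arrow A) : ℕ → Arrow A
  | 0 => f
  | n + 1 => Arrow.mk (Projective.d (iteratedCover f n).hom)

lemma projective_d_comp {M N : A} (f : M ⟶ N) : Projective.d f ≫ f = 0 := by
  have h : (Projective.π (kernel f) ≫ kernel.ι f) ≫ f = 0 := by
    rw [Category.assoc, kernel.condition, comp_zero]
  exact h

/-- The differential of `continuedComplex`. -/
def iteratedCoverD (f : Arrow A) (n : ℕ) :
    (iteratedCover f (n + 1)).right ⟶ (iteratedCover f n).right :=
  (iteratedCover f n).hom

/-- The chain complex continuing `f` to the left by projectives. -/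
def continuedComplex (f : Arrow A) : ChainComplex A ℕ :=
  ChainComplex.of (fun n => (iteratedCover f n).right) (iteratedCoverD f)
    (fun n => projective_d_comp (iteratedCover f n).hom)

lemma continuedComplex_d (f : Arrow A) (n : ℕ) :
    (continuedComplex f).d (n + 1) n = iteratedCoverD f n :=
  ChainComplex.of_d (fun n => (iteratedCover f n).right) (iteratedCoverD f) n

lemma continuedComplex_exactAt (f : Arrow A) (n : ℕ) : (continuedComplex f).ExactAt (n + 1) := by
  rw [HomologicalComplex.exactAt_iff' _ (n + 1 + 1) (n + 1) n (by simp) (by simp)]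
  have h := exact_d_f (iteratedCover f n).hom
  convert! h using 2
  · exact continuedComplex_d f (n + 1)
  · exact continuedComplex_d f n

lemma projective_continuedComplex (f : Arrow A) [Projective f.left] [Projective f.right] (n : ℕ) :
    Projective ((continuedComplex f).X n) := by
  change Projective (iteratedCover f n).right
  have : ∀ n, Projective (iteratedCover f n).left := fun n => by
    cases n with
    | zero => exact inferInstanceAs (Projective f.left)
    | succ n => exact Projective.projective_over _
  -- Degree `n + 1` of the complex is the source of the `n`-th iterated cover, by definition.
  cases n with
  | zero => exact inferInstanceAs (Projective f.right)
  | succ n => exact this n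

/-- Every morphism between projectives is the beginning of a projective resolution. -/
lemma exists_isProjRes (f : Arrow A) [Projective f.left] [Projective f.right] :
    ∃ P : CochainComplex A ℤ, IsProjRes P ∧ Nonempty (Arrow.mk (P.d (-1) 0) ≅ f) := by
  let K := continuedComplex f
  have hproj := projective_continuedComplex f
  -- The homological degree `k` is placed in cohomological degree `-k`, with zero in positive
  -- degrees.
  let e := ComplexShape.embeddingDownNat
  have hX (k : ℕ) (i : ℤ) (h : -(k : ℤ) = i) : (K.extend e).X i ≅ K.X k := K.extendXIso e h
  refine ⟨K.extend e, ⟨fun i hi => ?_, fun i => ?_, fun i hi => ?_⟩, ?_⟩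
  · exact K.isZero_extend_X e i (fun k hk => by
      have : -(k : ℤ) = i := hk
      omega)
  · by_cases hi : 0 < i
    · exact (K.isZero_extend_X e i (fun k hk => by
        have : -(k : ℤ) = i := hk
        omega)).projective
    · exact Projective.of_iso (hX i.natAbs i (by omega)).symm (hproj _)
  · by_cases hi' : 0 < i
    · exact ShortComplex.exact_of_isZero_X₂ _ (K.isZero_extend_X e i (fun k hk => by
        have : -(k : ℤ) = i := hk
        omega))
    · obtain ⟨k, hk⟩ : ∃ k : ℕ, -((k + 1 : ℕ) : ℤ) = i := ⟨i.natAbs - 1, by omega⟩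
      exact (K.extend_exactAt_iff e (j := k + 1) hk).2 (continuedComplex_exactAt f k)
  · have h1 : e.f 1 = -1 := rfl
    have h0 : e.f 0 = 0 := rfl
    refine ⟨Arrow.isoMk (K.extendXIso e h1) (K.extendXIso e h0) ?_⟩
    suffices h : (K.extendXIso e h1).hom ≫ K.d 1 0 =
        (K.extend e).d (-1) 0 ≫ (K.extendXIso e h0).hom from
      (congrArg ((K.extendXIso e h1).hom ≫ ·) (continuedComplex_d f 0).symm).trans h
    rw [K.extend_d_eq e h1 h0, Category.assoc, Category.assoc, Iso.inv_hom_id, Category.comp_id]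

/-- Every object has a projective resolution. -/
lemma exists_isProjRes_resolved (M : A) :
    ∃ P : CochainComplex A ℤ, IsProjRes P ∧ Nonempty (resolved P ≅ M) := by
  let f : Arrow A := Arrow.mk (Projective.d (Projective.π M))
  have : Projective f.left := Projective.projective_over _
  have : Projective f.right := Projective.projective_over _
  obtain ⟨P, hP, ⟨e⟩⟩ := exists_isProjRes f
  refine ⟨P, hP, ⟨?_⟩⟩
  have h1 := P.opcyclesIsCokernel (-1) 0 (by simp)
  have h2 : IsColimit (CokernelCofork.ofπ (Projective.π M) (ShortComplex.zero _)) :=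
    (exact_d_f (Projective.π M)).gIsCokernel
  exact (cokernel.mapIso _ _ (Arrow.leftFunc.mapIso e) (Arrow.rightFunc.mapIso e) e.hom.w.symm)
    |> fun i => (h1.coconePointUniqueUpToIso (cokernelIsCokernel _)) ≪≫ i ≪≫
      ((cokernelIsCokernel _).coconePointUniqueUpToIso h2)

end Existence

end ProjectiveComplexes

/-! ### Cones of identities and null-homotopies -/

section Contractible

variable {A : Type u} [Category.{v} A] [Preadditive A] [HasBinaryBiproducts A]

/-- A contracting homotopy `s` satisfies `δ s = 𝟙`, so by the Leibniz rule every cocycle `z` is, up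
to sign, the coboundary of `s.comp z`. -/
lemma homVanishes_mappingCone_id (K Y : CochainComplex A ℤ) (n : ℤ) :
    HomVanishes (mappingCone (𝟙 K)) Y n := fun z => by
  rw [mem_coboundaries_iff _ (n - 1) (by simp)]
  let s := Cochain.ofHomotopy (mappingCone.homotopyToZeroOfId K)
  have hs : δ (-1) 0 s = Cochain.ofHom (𝟙 _) := by
    rw [δ_ofHomotopy, Cochain.ofHom_zero, sub_zero]
  refine ⟨n.negOnePow • s.comp z.1 (by ring), ?_⟩
  rw [δ_units_smul, δ_comp s z.1 _ 0 (n + 1) n (by simp) (by simp) rfl, hs, z.δ_eq_zero]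
  simp [smul_smul]

/-- Extending `f` over the cone of the identity amounts to choosing a null-homotopy of `f`. -/
lemma exists_inr_comp_iff {K Y : CochainComplex A ℤ} (f : K ⟶ Y) :
    (∃ g : mappingCone (𝟙 K) ⟶ Y, mappingCone.inr (𝟙 K) ≫ g = f) ↔
      Cocycle.ofHom f ∈ coboundaries K Y 0 := by
  rw [mem_coboundaries_iff _ (-1) (by simp)]
  constructor
  · rintro ⟨g, rfl⟩
    obtain ⟨β, hβ⟩ := (mem_coboundaries_iff _ (-1) (by simp)).1
      (homVanishes_mappingCone_id K Y 0 (Cocycle.ofHom g))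
    refine ⟨(Cochain.ofHom (mappingCone.inr (𝟙 K))).comp β (zero_add _), ?_⟩
    rw [δ_ofHom_comp, hβ]
    simp
  · rintro ⟨β, hβ⟩
    refine ⟨mappingCone.desc (𝟙 K) β f (by rw [hβ]; simp), by simp⟩

lemma homVanishes_iff_shift {A : Type u} [Category.{v} A] [Preadditive A]
    (P Q : CochainComplex A ℤ) (n m : ℤ) (h : n + m = 0) :
    HomVanishes P Q m ↔ ∀ f : P⟦n⟧ ⟶ Q, Cocycle.ofHom f ∈ coboundaries (P⟦n⟧) Q 0 := by
  constructor
  · intro hPQ f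
    let z : Cocycle P Q m := (Cocycle.ofHom f).leftUnshift m (by omega)
    obtain ⟨β, hβ⟩ := (mem_coboundaries_iff z (m - 1) (by simp)).1 (hPQ z)
    rw [mem_coboundaries_iff _ (-1) (by simp)]
    refine ⟨n.negOnePow • β.leftShift n (-1) (by omega), ?_⟩
    rw [δ_units_smul, β.δ_leftShift n (-1) 0 (by omega) m (by omega), smul_smul, hβ]
    simp [z]
  · intro h z
    obtain ⟨β, hβ⟩ := (mem_coboundaries_iff _ (-1) (by simp)).1
      (h (Cocycle.homOf (z.leftShift n 0 (by omega))))
    rw [mem_coboundaries_iff _ (m - 1) (by simp)]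
    refine ⟨n.negOnePow • β.leftUnshift (m - 1) (by omega), ?_⟩
    rw [δ_units_smul, β.δ_leftUnshift (m - 1) (by omega) m 0 (by omega), smul_smul, hβ]
    simp

end Contractible

section Pointwise

variable {R : Type v} [CommRing R] {C : Type u} [Category.{v} C]

lemma surjective_app_of_epi {M N : Cᵒᵖ ⥤ ModuleCat.{v} R} (p : M ⟶ N) [Epi p] (X : Cᵒᵖ) :
    Function.Surjective (p.app X) :=
  (ModuleCat.epi_iff_surjective _).1 inferInstance

lemma injective_app_of_mono {M N : Cᵒᵖ ⥤ ModuleCat.{v} R} (p : M ⟶ N) [Mono p] (X : Cᵒᵖ) :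
    Function.Injective (p.app X) :=
  (ModuleCat.mono_iff_injective _).1 inferInstance

end Pointwise

/-! ### Closure properties of finitely presented functors -/

section FinitelyPresented

variable {R : Type v} [CommRing R] {C : Type u} [Category.{v} C] [Preadditive C] [Linear R C]

instance : (finPres R C).IsClosedUnderIsomorphisms where
  of_iso e := fun ⟨f, ⟨i⟩⟩ => ⟨f, ⟨i ≪≫ e⟩⟩

instance : (linearYoneda R C).Additive where
  map_add {X Y f g} := by
    ext Z (h : Z.unop ⟶ X)
    exact Preadditive.comp_add _ _ _ h f g

/-- `M` is presented by `f` through `q`. -/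
lemma finPres_iff {M : Cᵒᵖ ⥤ ModuleCat.{v} R} : finPres R C M ↔
    ∃ (A₁ A₀ : C) (f : A₁ ⟶ A₀) (q : (linearYoneda R C).obj A₀ ⟶ M)
      (w : (linearYoneda R C).map f ≫ q = 0), Nonempty (IsColimit (CokernelCofork.ofπ q w)) := by
  constructor
  · rintro ⟨φ, ⟨e'⟩⟩
    let e : cokernel ((linearYoneda R C).map φ.hom) ≅ M := e'
    refine ⟨φ.left, φ.right, φ.hom, cokernel.π ((linearYoneda R C).map φ.hom) ≫ e.hom,
      by rw [cokernel.condition_assoc, zero_comp], ⟨?_⟩⟩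
    exact IsColimit.ofIsoColimit (cokernelIsCokernel ((linearYoneda R C).map φ.hom))
      (Cofork.ext e rfl)
  · rintro ⟨A₁, A₀, f, q, w, ⟨h⟩⟩
    exact ⟨Arrow.mk f, ⟨(cokernelIsCokernel _).coconePointUniqueUpToIso h⟩⟩

lemma finPres.exists_epi {M : Cᵒᵖ ⥤ ModuleCat.{v} R} (hM : finPres R C M) :
    ∃ (A : C) (q : (linearYoneda R C).obj A ⟶ M), Epi q := by
  obtain ⟨A₁, A₀, f, q, w, ⟨h⟩⟩ := finPres_iff.1 hM
  exact ⟨A₀, q, Cofork.IsColimit.epi h⟩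

/-- A morphism from a representable functor is determined by its value at the identity. -/
lemma linearYoneda_hom_ext {A : C} {N : Cᵒᵖ ⥤ ModuleCat.{v} R}
    (s t : (linearYoneda R C).obj A ⟶ N)
    (h : s.app (op A) (𝟙 A : A ⟶ A) = t.app (op A) (𝟙 A : A ⟶ A)) : s = t := by
  ext X b
  have hs := NatTrans.naturality_apply s (b : X.unop ⟶ A).op (𝟙 A : A ⟶ A)
  have ht := NatTrans.naturality_apply t (b : X.unop ⟶ A).op (𝟙 A : A ⟶ A)
  have hb : ((linearYoneda R C).obj A).map (b : X.unop ⟶ A).op (𝟙 A : A ⟶ A) = b :=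
    Category.comp_id (b : X.unop ⟶ A)
  rw [hb] at hs ht
  exact hs.trans ((congrArg _ h).trans ht.symm)

lemma finPres.exists_hom {M : Cᵒᵖ ⥤ ModuleCat.{v} R} (hM : finPres R C M) {A : C}
    (x : M.obj (op A)) :
    ∃ t : (linearYoneda R C).obj A ⟶ M, t.app (op A) (𝟙 A : A ⟶ A) = x := by
  obtain ⟨B, q, hq⟩ := hM.exists_epi
  obtain ⟨a, ha⟩ := surjective_app_of_epi q (op A) x
  refine ⟨(linearYoneda R C).map (a : A ⟶ B) ≫ q, ?_⟩
  have h1 : ((linearYoneda R C).map (a : A ⟶ B)).app (op A) (𝟙 A : A ⟶ A) = a :=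
    Category.id_comp (a : A ⟶ B)
  change q.app (op A) (((linearYoneda R C).map (a : A ⟶ B)).app (op A) (𝟙 A : A ⟶ A)) = x
  rw [h1, ha]

lemma finPres.exists_lift {M N : Cᵒᵖ ⥤ ModuleCat.{v} R} (hM : finPres R C M) (p : M ⟶ N) [Epi p]
    {A : C} (s : (linearYoneda R C).obj A ⟶ N) :
    ∃ t : (linearYoneda R C).obj A ⟶ M, t ≫ p = s := by
  obtain ⟨x, hx⟩ := surjective_app_of_epi p (op A) (s.app (op A) (𝟙 A : A ⟶ A))
  obtain ⟨t, ht⟩ := hM.exists_hom x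
  refine ⟨t, linearYoneda_hom_ext _ _ ?_⟩
  change p.app (op A) (t.app (op A) (𝟙 A : A ⟶ A)) = _
  rw [ht, hx]

variable (R) in
lemma finPres_linearYoneda' (A : C) : finPres R C ((linearYoneda R C).obj A) := by
  have w : (linearYoneda R C).map (0 : A ⟶ A) ≫ 𝟙 _ = 0 := by simp
  refine finPres_iff.2 ⟨A, A, 0, 𝟙 _, w, ⟨?_⟩⟩
  exact CokernelCofork.IsColimit.ofId _ (by simp)

section Biproducts

variable [HasBinaryBiproducts C]

/-- Cover `M` by `(-, A)` and lift `(-, A) ⟶ M ⟶ N` to `a : A ⟶ B₀`. The cokernel is then `(-, B₀)`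
modulo the old relations `b` and the new ones `a`. -/
instance : (finPres R C).IsClosedUnderCokernels where
  cokernels_le := by
    rintro _ ⟨f, k, hk, hM, hN⟩
    obtain ⟨A, p, hp⟩ := finPres.exists_epi hM
    obtain ⟨B₁, B₀, b, q, w, ⟨hq⟩⟩ := finPres_iff.1 hN
    have hq' : Epi q := Cofork.IsColimit.epi hq
    obtain ⟨t, ht⟩ := (finPres_linearYoneda' R B₀).exists_lift q (p ≫ f)
    obtain ⟨a, rfl⟩ := (linearYoneda R C).map_surjective t
    have hk' : Epi k.π := Cofork.IsColimit.epi hk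
    have w' : (linearYoneda R C).map (biprod.desc a b) ≫ q ≫ k.π = 0 := by
      have : biprod.desc a b = biprod.fst ≫ a + biprod.snd ≫ b := by ext <;> simp
      rw [this, Functor.map_add, Functor.map_comp, Functor.map_comp, Preadditive.add_comp,
        Category.assoc, Category.assoc, reassoc_of% w, reassoc_of% ht, k.condition]
      simp
    refine finPres_iff.2 ⟨_, _, biprod.desc a b, q ≫ k.π, w', ⟨?_⟩⟩
    refine CokernelCofork.IsColimit.ofπ' _ _ fun {W} s hs => ?_
    have ha : (linearYoneda R C).map a ≫ s = 0 := by
      rw [← biprod.inl_desc a b, Functor.map_comp, Category.assoc, hs, comp_zero]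
    have hb : (linearYoneda R C).map b ≫ s = 0 := by
      rw [← biprod.inr_desc a b, Functor.map_comp, Category.assoc, hs, comp_zero]
    obtain ⟨s', hs'⟩ := CokernelCofork.IsColimit.desc' hq s hb
    have hs'' : q ≫ s' = s := hs'
    have h0 : f ≫ s' = 0 := by
      rw [← cancel_epi p, comp_zero, ← Category.assoc, ← ht, Category.assoc, hs'', ha]
    obtain ⟨s₂, hs₂⟩ := CokernelCofork.IsColimit.desc' hk s' h0
    exact ⟨s₂, by rw [Category.assoc, hs₂, hs'']⟩

lemma finPres_biprod {M N : Cᵒᵖ ⥤ ModuleCat.{v} R} (hM : finPres R C M) (hN : finPres R C N) :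
    finPres R C (M ⊞ N) := by
  obtain ⟨A₁, A₀, a, p, wa, ⟨hp⟩⟩ := finPres_iff.1 hM
  obtain ⟨B₁, B₀, b, q, wb, ⟨hq⟩⟩ := finPres_iff.1 hN
  have hp' : Epi p := Cofork.IsColimit.epi hp
  have hq' : Epi q := Cofork.IsColimit.epi hq
  let Y := linearYoneda R C
  have w : Y.map (biprod.map a b) ≫ biprod.lift (Y.map biprod.fst ≫ p) (Y.map biprod.snd ≫ q) =
      0 := by
    apply biprod.hom_ext
    · simp only [Category.assoc, biprod.lift_fst, zero_comp]
      rw [← Category.assoc, ← Functor.map_comp, biprod.map_fst, Functor.map_comp, Category.assoc,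
        wa, comp_zero]
    · simp only [Category.assoc, biprod.lift_snd, zero_comp]
      rw [← Category.assoc, ← Functor.map_comp, biprod.map_snd, Functor.map_comp, Category.assoc,
        wb, comp_zero]
  refine finPres_iff.2 ⟨_, _, biprod.map a b, _, w, ⟨?_⟩⟩
  have hinl : Y.map biprod.inl ≫ biprod.lift (Y.map biprod.fst ≫ p) (Y.map biprod.snd ≫ q) =
      p ≫ biprod.inl := by
    apply biprod.hom_ext
    · rw [Category.assoc, biprod.lift_fst, ← Category.assoc, ← Functor.map_comp, biprod.inl_fst,
        Y.map_id, Category.id_comp, Category.assoc, biprod.inl_fst, Category.comp_id]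
    · rw [Category.assoc, biprod.lift_snd, ← Category.assoc, ← Functor.map_comp, biprod.inl_snd,
        Functor.map_zero, zero_comp, Category.assoc, biprod.inl_snd, comp_zero]
  have hinr : Y.map biprod.inr ≫ biprod.lift (Y.map biprod.fst ≫ p) (Y.map biprod.snd ≫ q) =
      q ≫ biprod.inr := by
    apply biprod.hom_ext
    · rw [Category.assoc, biprod.lift_fst, ← Category.assoc, ← Functor.map_comp, biprod.inr_fst,
        Functor.map_zero, zero_comp, Category.assoc, biprod.inr_fst, comp_zero]
    · rw [Category.assoc, biprod.lift_snd, ← Category.assoc, ← Functor.map_comp, biprod.inr_snd,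
        Y.map_id, Category.id_comp, Category.assoc, biprod.inr_snd, Category.comp_id]
  have htot : Y.map biprod.fst ≫ Y.map biprod.inl + Y.map biprod.snd ≫ Y.map biprod.inr =
      𝟙 (Y.obj (A₀ ⊞ B₀)) := by
    rw [← Functor.map_comp, ← Functor.map_comp, ← Functor.map_add, biprod.total, Y.map_id]
  have hepi : Epi (biprod.lift (Y.map biprod.fst ≫ p) (Y.map biprod.snd ≫ q)) := by
    refine Preadditive.epi_of_cancel_zero _ fun {W} g hg => ?_
    apply biprod.hom_ext'
    · rw [← cancel_epi p, ← Category.assoc, ← hinl, Category.assoc, hg]; simp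
    · rw [← cancel_epi q, ← Category.assoc, ← hinr, Category.assoc, hg]; simp
  refine CokernelCofork.IsColimit.ofπ' _ _ fun {W} s hs => ?_
  have ha : Y.map a ≫ Y.map biprod.inl ≫ s = 0 := by
    rw [← Functor.map_comp_assoc, ← biprod.inl_map a b, Functor.map_comp_assoc, hs, comp_zero]
  have hb : Y.map b ≫ Y.map biprod.inr ≫ s = 0 := by
    rw [← Functor.map_comp_assoc, ← biprod.inr_map a b, Functor.map_comp_assoc, hs, comp_zero]
  obtain ⟨s₁, hs₁⟩ := CokernelCofork.IsColimit.desc' hp _ ha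
  obtain ⟨s₂, hs₂⟩ := CokernelCofork.IsColimit.desc' hq _ hb
  have hs₁' : p ≫ s₁ = Y.map biprod.inl ≫ s := hs₁
  have hs₂' : q ≫ s₂ = Y.map biprod.inr ≫ s := hs₂
  refine ⟨biprod.desc s₁ s₂, ?_⟩
  rw [biprod.lift_desc, Category.assoc, Category.assoc, hs₁', hs₂', ← Category.assoc,
    ← Category.assoc, ← Preadditive.add_comp, htot, Category.id_comp]

instance [HasZeroObject C] : (finPres R C).ContainsZero where
  exists_zero := ⟨(linearYoneda R C).obj 0, by
    rw [IsZero.iff_id_eq_zero, ← (linearYoneda R C).map_id,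
      (isZero_zero C).eq_of_src (𝟙 (0 : C)) 0, Functor.map_zero], finPres_linearYoneda' R 0⟩

instance : (finPres R C).IsClosedUnderBinaryProducts where
  limitsOfShape_le := by
    rintro X ⟨p⟩
    have e := IsLimit.conePointsIsoOfNatIso p.isLimit (BinaryBiproduct.isLimit _ _)
      (diagramIsoPair p.diag)
    exact (finPres R C).prop_of_iso e.symm (finPres_biprod (p.prop_diag_obj _) (p.prop_diag_obj _))

instance [HasZeroObject C] : (finPres R C).IsClosedUnderFiniteProducts :=
  ObjectProperty.IsClosedUnderFiniteProducts.mk'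

end Biproducts

/-- If `mod(C)` has kernels, they are computed pointwise. -/
lemma isClosedUnderKernels_finPres (h : HasKernels (FPMod R C)) :
    (finPres R C).IsClosedUnderKernels where
  kernels_le := by
    rintro _ ⟨f, c, hc, hM, hN⟩
    let f' : (⟨_, hM⟩ : FPMod R C) ⟶ ⟨_, hN⟩ := ObjectProperty.homMk f
    let k := (kernel.ι f').hom
    have hk : k ≫ f = 0 := congrArg (fun t => t.hom) (kernel.condition f')
    have hY (A : C) : finPres R C ((linearYoneda R C).obj A) := finPres_linearYoneda' R A
    -- Elements at `A` are maps from the finitely presented functor `(-, A)`, so the universal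
    -- property of the kernel in `mod(C)` can be read off on elements.
    have hinj (A : C) : Function.Injective (k.app (op A)) := by
      rw [injective_iff_map_eq_zero]
      intro y hy
      obtain ⟨t, rfl⟩ := (kernel f').property.exists_hom y
      let t' : (⟨_, hY A⟩ : FPMod R C) ⟶ kernel f' := ObjectProperty.homMk t
      have h1 : t ≫ k = 0 := linearYoneda_hom_ext _ _ hy
      have h2 : t' ≫ kernel.ι f' = 0 := ObjectProperty.hom_ext _ h1
      have h3 : t' = 0 := zero_of_comp_mono _ h2
      have h4 : t = 0 := congrArg (fun t => t.hom) h3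
      rw [h4]
      rfl
    have hsurj (A : C) (x : _) (hx : f.app (op A) x = 0) : ∃ y, k.app (op A) y = x := by
      obtain ⟨t, rfl⟩ := hM.exists_hom x
      let t' : (⟨_, hY A⟩ : FPMod R C) ⟶ ⟨_, hM⟩ := ObjectProperty.homMk t
      have h1 : t ≫ f = 0 := linearYoneda_hom_ext _ _ hx
      have h2 : t' ≫ f' = 0 := ObjectProperty.hom_ext _ h1
      have h3 : (kernel.lift f' t' h2).hom ≫ k = t :=
        congrArg (fun t => t.hom) (kernel.lift_ι f' t' h2)
      refine ⟨(kernel.lift f' t' h2).hom.app (op A) (𝟙 A : A ⟶ A), ?_⟩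
      rw [← h3]
      rfl
    have hmono : Mono k := by
      have (X : Cᵒᵖ) : Mono (k.app X) := (ModuleCat.mono_iff_injective _).2 (hinj X.unop)
      exact NatTrans.mono_of_mono_app k
    have hc' : Mono c.ι := Fork.IsLimit.mono hc
    -- `l` compares the kernel in `mod(C)` with the one among all functors; it is mono and epi,
    -- hence invertible.
    obtain ⟨l, hl⟩ := KernelFork.IsLimit.lift' hc k hk
    have hl1 : Mono l := by
      have : Mono (l ≫ c.ι) := by rw [hl]; exact hmono
      exact mono_of_mono l c.ι
    have hl2 : Epi l := by
      have (X : Cᵒᵖ) : Epi (l.app X) := by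
        rw [ModuleCat.epi_iff_surjective]
        intro y
        have hy : f.app X (c.ι.app X y) = 0 := by
          change (c.ι ≫ f).app X y = 0
          rw [c.condition]
          simp
        obtain ⟨z, hz⟩ := hsurj X.unop _ hy
        refine ⟨z, injective_app_of_mono c.ι X ?_⟩
        rw [← hz, ← hl]
        rfl
      exact NatTrans.epi_of_epi_app l
    have : IsIso l := isIso_of_mono_of_epi l
    exact (finPres R C).prop_of_iso (asIso l) (kernel f').property

/-- In a dualizing variety, `mod(C)` is closed under kernels. -/
lemma IsDualizing.isClosedUnderKernels [HasFiniteBiproducts C] {I : Type v} [AddCommGroup I]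
    [Module R I] (hC : IsDualizing R C I) : (finPres R C).IsClosedUnderKernels := by
  obtain ⟨h, hG⟩ := hC.duality
  have : HasBinaryBiproducts C := hasBinaryBiproducts_of_finite_biproducts C
  have : HasBinaryBiproducts Cᵒᵖ := HasBinaryBiproducts.of_hasBinaryProducts
  -- Cokernels exist in `mod(Cᵒᵖ)`; the duality turns them into kernels in `mod(C)`.
  have h1 : HasCokernels (FPMod R Cᵒᵖ) := inferInstance
  have h2 : HasCoequalizers (FPMod R Cᵒᵖ) := Preadditive.hasCoequalizers_of_hasCokernels
  have h3 : HasCoequalizers (FPMod R C)ᵒᵖ :=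
    Adjunction.hasColimitsOfShape_of_equivalence
      ((finPres R Cᵒᵖ).lift ((finPres R C).ι.op ⋙ dual R C I) h)
  have h4 : HasColimitsOfShape WalkingParallelPairᵒᵖ (FPMod R C)ᵒᵖ :=
    hasColimitsOfShape_of_equivalence walkingParallelPairOpEquiv
  have h5 : HasEqualizers (FPMod R C) := hasLimitsOfShape_of_hasColimitsOfShape_op
  exact isClosedUnderKernels_finPres inferInstance

end FinitelyPresented

lemma exists_iso_of_isColimit_cokernelCofork {A : Type u} [Category.{v} A] [HasZeroMorphisms A]
    {X₁ X₀ Y₁ Y₀ M N : A} {f : X₁ ⟶ X₀} {g : Y₁ ⟶ Y₀} {p : X₀ ⟶ M} {q : Y₀ ⟶ N} {wp : f ≫ p = 0}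
    {wq : g ≫ q = 0} (hp : IsColimit (CokernelCofork.ofπ p wp))
    (hq : IsColimit (CokernelCofork.ofπ q wq)) (e : Arrow.mk f ≅ Arrow.mk g) :
    Nonempty (M ≅ N) :=
  have : HasCokernel f := ⟨⟨⟨_, hp⟩⟩⟩
  have : HasCokernel g := ⟨⟨⟨_, hq⟩⟩⟩
  ⟨hp.coconePointUniqueUpToIso (cokernelIsCokernel f) ≪≫
    cokernel.mapIso f g (Arrow.leftFunc.mapIso e) (Arrow.rightFunc.mapIso e) e.hom.w.symm ≪≫
    (cokernelIsCokernel g).coconePointUniqueUpToIso hq⟩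

/-! ### Representable functors and projective objects -/

section Representables

variable {R : Type v} [CommRing R] {C : Type u} [Category.{v} C] [Preadditive C] [Linear R C]
  [HasZeroObject C]

instance : (yonedaFP R C).Full := inferInstanceAs ((finPres R C).lift _ _).Full

instance : (yonedaFP R C).Faithful := inferInstanceAs ((finPres R C).lift _ _).Faithful

instance : (yonedaFP R C).Additive where
  map_add := ObjectProperty.hom_ext _ ((linearYoneda R C).map_add)

lemma exists_epi_yonedaFP (M : FPMod R C) :
    ∃ (A : C) (q : (yonedaFP R C).obj A ⟶ M), Epi q := by
  obtain ⟨A, q, hq⟩ := finPres.exists_epi M.property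
  exact ⟨A, ObjectProperty.homMk q, (finPres R C).ι.epi_of_epi_map hq⟩

variable (R) in
/-- The projection of `(-, A₀)` onto `Φ(A₁ ⟶ A₀)`. -/
def phiπ (X : Arrow C) : (yonedaFP R C).obj X.right ⟶ (Phi R C).obj X :=
  ObjectProperty.homMk (cokernel.π ((linearYoneda R C).map X.hom))

lemma map_hom_phiπ (X : Arrow C) : (yonedaFP R C).map X.hom ≫ phiπ R X = 0 :=
  ObjectProperty.hom_ext _ (cokernel.condition _)

lemma phiπ_naturality {X Y : Arrow C} (h : X ⟶ Y) :
    phiπ R X ≫ (Phi R C).map h = (yonedaFP R C).map h.right ≫ phiπ R Y :=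
  ObjectProperty.hom_ext _ (cokernel.π_desc _ _ _)

/-- The projective objects of `mod(C)` are representable. -/
lemma exists_iso_yonedaFP [IsIdempotentComplete C] (P : FPMod R C) [Projective P] :
    ∃ A : C, Nonempty ((yonedaFP R C).obj A ≅ P) := by
  obtain ⟨A, q, hq⟩ := exists_epi_yonedaFP P
  -- `P` is a retract of `(-, A)`. By Yoneda the idempotent `q ≫ s` comes from one of `A`, whose
  -- splitting represents `P`.
  let s := Projective.factorThru (𝟙 P) q
  have hs : s ≫ q = 𝟙 P := Projective.factorThru_comp _ _
  obtain ⟨p, hp⟩ := (yonedaFP R C).map_surjective (q ≫ s)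
  obtain ⟨B, i, e, hie, hei⟩ := IsIdempotentComplete.idempotents_split A p
    ((yonedaFP R C).map_injective (by
      rw [Functor.map_comp, hp, Category.assoc, reassoc_of% hs]))
  refine ⟨B, ⟨(yonedaFP R C).map i ≫ q, s ≫ (yonedaFP R C).map e, ?_, ?_⟩⟩
  · rw [Category.assoc, ← Category.assoc q, ← hp, ← hei, ← Functor.map_comp, ← Functor.map_comp,
      Category.assoc, hie, Category.comp_id, hie, (yonedaFP R C).map_id]
  · rw [Category.assoc, ← Category.assoc ((yonedaFP R C).map e), ← Functor.map_comp, hei, hp]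
    rw [Category.assoc, reassoc_of% hs, hs]

end Representables

/-! ### The abelian category `mod(C)` -/

section FinitelyPresented

variable {R : Type v} [CommRing R] {C : Type u} [Category.{v} C] [Preadditive C] [Linear R C]
  [HasZeroObject C] [HasBinaryBiproducts C] [(finPres R C).IsClosedUnderKernels]

instance : (finPres R C).ι.PreservesHomology where
  preservesKernels _ _ f := ObjectProperty.preservesKernels_ι _ f
  preservesCokernels _ _ f := ObjectProperty.preservesCokernels_ι _ f

variable (R C) in
-- The inclusion into all functors is exact and faithful, so it preserves and reflects short
-- exactness. This lets the results on abelian categories apply to `mod(C)`.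
lemma exactSeq_eq : exactSeq R C = shortExactSeq (FPMod R C) := by
  ext K
  refine ⟨fun h => ?_, fun h => ?_⟩
  swap
  · have := ObjectProperty.preservesMonomorphisms_ι_of_isNormalEpiCategory (finPres R C)
    have := ObjectProperty.preservesEpimorphisms_ι_of_isNormalMonoCategory (finPres R C)
    have h' : K.ShortExact := h
    have := h'.mono_f
    have := h'.epi_g
    exact h'.map (finPres R C).ι
  have h' : (K.map (finPres R C).ι).ShortExact := h
  have h1 : Mono ((finPres R C).ι.map K.f) := h'.mono_f
  have h2 : Epi ((finPres R C).ι.map K.g) := h'.epi_g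
  exact
    { exact := (ShortComplex.exact_map_iff_of_faithful K (finPres R C).ι).1 h'.exact
      mono_f := (finPres R C).ι.mono_of_mono_map h1
      epi_g := (finPres R C).ι.epi_of_epi_map h2 }

lemma exactAt_mapHomologicalComplex_ι_iff (P : CochainComplex (FPMod R C) ℤ) (i : ℤ) :
    (((finPres R C).ι.mapHomologicalComplex _).obj P).ExactAt i ↔ P.ExactAt i :=
  ShortComplex.exact_map_iff_of_faithful (P.sc i) (finPres R C).ι

lemma projRes_iff (P : CMinus R C) : projRes R C P ↔ IsProjRes P.obj := by
  simp only [projRes, exactSeq_eq, relProjective_shortExactSeq_iff,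
    exactAt_mapHomologicalComplex_ι_iff]
  exact ⟨fun ⟨h₁, h₂, h₃⟩ => ⟨h₁, h₂, h₃⟩, fun ⟨h₁, h₂, h₃⟩ => ⟨h₁, h₂, h₃⟩⟩

lemma PZero.isProjRes (P : PZero R C) : IsProjRes P.obj.obj :=
  (projRes_iff _).1 P.property

/-- The object of `P⁰(mod(C))` given by a projective resolution. -/
def IsProjRes.toPZero {P : CochainComplex (FPMod R C) ℤ} (hP : IsProjRes P) : PZero R C :=
  ⟨⟨P, 0, hP.isZero⟩, (projRes_iff _).2 hP⟩

instance projective_yonedaFP (A : C) : Projective ((yonedaFP R C).obj A) := by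
  rw [← relProjective_shortExactSeq_iff, ← exactSeq_eq]
  exact relProjective_yonedaFP R A

instance : EnoughProjectives (FPMod R C) where
  presentation M := by
    obtain ⟨A, q, hq⟩ := exists_epi_yonedaFP M
    exact ⟨⟨_, q⟩⟩

/-! ### The functor `Φ` -/

variable (R) in
/-- `Φ(f)` is the cokernel of `(-, f)` in `mod(C)`. -/
def phiIsCokernel (X : Arrow C) : IsColimit (CokernelCofork.ofπ (phiπ R X) (map_hom_phiπ X)) :=
  isColimitOfReflects (finPres R C).ι ((CokernelCofork.isColimitMapCoconeEquiv _ _).symm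
    (cokernelIsCokernel ((linearYoneda R C).map X.hom) :))

instance (X : Arrow C) : Epi (phiπ R X) := Cofork.IsColimit.epi (phiIsCokernel R X)

/-- The presentation of `Φ(X)` is exact at `(-, X.right)` and `(-, A)` is projective, so the map
lifts; Yoneda brings the lift back to `C`. -/
lemma exists_comp_map_hom {X : Arrow C} {A : C} (a : A ⟶ X.right)
    (ha : (yonedaFP R C).map a ≫ phiπ R X = 0) : ∃ s : A ⟶ X.left, a = s ≫ X.hom := by
  have h := ShortComplex.exact_of_g_is_cokernel (ShortComplex.mk _ _ (map_hom_phiπ X))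
    (phiIsCokernel R X)
  obtain ⟨s, hs⟩ := (yonedaFP R C).map_surjective (h.liftFromProjective _ ha)
  refine ⟨s, (yonedaFP R C).map_injective ?_⟩
  rw [Functor.map_comp, hs]
  exact (h.liftFromProjective_comp _ ha).symm

/-- Faithfulness of `Φ` modulo homotopy. With fullness, it shows that isomorphic images come from
homotopy equivalent maps. -/
lemma mapsHomotopic_of_phi_map_eq {X Y : Arrow C} {h h' : X ⟶ Y}
    (e : (Phi R C).map h = (Phi R C).map h') : MapsHomotopic h h' := by
  apply exists_comp_map_hom (R := R)
  rw [Functor.map_sub, Preadditive.sub_comp, ← phiπ_naturality, ← phiπ_naturality, e, sub_self]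

instance : (Phi R C).Full where
  map_surjective {X Y} f := by
    obtain ⟨a, ha⟩ := (yonedaFP R C).map_surjective
      (Projective.factorThru (phiπ R X ≫ f) (phiπ R Y))
    have ha' : (yonedaFP R C).map a ≫ phiπ R Y = phiπ R X ≫ f := by
      rw [ha, Projective.factorThru_comp]
    obtain ⟨s, hs⟩ := exists_comp_map_hom (R := R) (X := Y) (X.hom ≫ a) (by
      rw [Functor.map_comp, Category.assoc, ha', ← Category.assoc, map_hom_phiπ, zero_comp])
    refine ⟨Arrow.homMk s a hs.symm, ?_⟩
    rw [← cancel_epi (phiπ R X), phiπ_naturality]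
    exact ha'

lemma HomotopyClosed.of_phi_iso {T : ObjectProperty (Arrow C)} (hT : HomotopyClosed T)
    {X Y : Arrow C} (e : (Phi R C).obj X ≅ (Phi R C).obj Y) (hX : T X) : T Y := by
  obtain ⟨a, ha⟩ := (Phi R C).map_surjective e.hom
  obtain ⟨b, hb⟩ := (Phi R C).map_surjective e.inv
  refine hT X Y a b (mapsHomotopic_of_phi_map_eq (R := R) ?_)
    (mapsHomotopic_of_phi_map_eq (R := R) ?_) hX
  · rw [Functor.map_comp, ha, hb, e.hom_inv_id, (Phi R C).map_id]
  · rw [Functor.map_comp, ha, hb, e.inv_hom_id, (Phi R C).map_id]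

/-! ### Objects of `maps(C)` and projective resolutions -/

/-- Both objects are cokernels of isomorphic arrows. This is the identity `Φ(Ψ(P)) ≅ resolved P`. -/
lemma IsPsi.exists_iso {P : PZero R C} {X : Arrow C} (h : IsPsi R P X) :
    Nonempty (resolved P.obj.obj ≅ (Phi R C).obj X) := by
  obtain ⟨e⟩ := h
  exact exists_iso_of_isColimit_cokernelCofork (P.obj.obj.opcyclesIsCokernel (-1) 0 (by simp))
    (phiIsCokernel R X) e

lemma exists_isPsi_of_arrow (X : Arrow C) : ∃ P : PZero R C, IsPsi R P X := by
  have : Projective (Arrow.mk ((yonedaFP R C).map X.hom)).left := projective_yonedaFP X.left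
  have : Projective (Arrow.mk ((yonedaFP R C).map X.hom)).right := projective_yonedaFP X.right
  obtain ⟨P, hP, h⟩ := exists_isProjRes (Arrow.mk ((yonedaFP R C).map X.hom))
  exact ⟨hP.toPZero, h⟩

lemma exists_isPsi [IsIdempotentComplete C] (P : PZero R C) : ∃ X : Arrow C, IsPsi R P X := by
  have := P.isProjRes.projective
  obtain ⟨A₁, ⟨e₁⟩⟩ := exists_iso_yonedaFP (P.obj.obj.X (-1))
  obtain ⟨A₀, ⟨e₀⟩⟩ := exists_iso_yonedaFP (P.obj.obj.X 0)
  obtain ⟨f, hf⟩ := (yonedaFP R C).map_surjective (e₁.hom ≫ P.obj.obj.d (-1) 0 ≫ e₀.inv)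
  exact ⟨Arrow.mk f, ⟨Arrow.isoMk e₁.symm e₀.symm (by simp [hf])⟩⟩

lemma psiPreimage.map_phi {T : ObjectProperty (Arrow C)} {P : PZero R C} (h : psiPreimage R T P) :
    T.map (Phi R C) (resolved P.obj.obj) := by
  obtain ⟨X, hX, hP⟩ := h
  obtain ⟨e⟩ := hP.exists_iso
  exact ⟨_, hX, ⟨e.symm⟩⟩

lemma exists_psiPreimage {T : ObjectProperty (Arrow C)} {M : FPMod R C}
    (h : T.map (Phi R C) M) : ∃ P, psiPreimage R T P ∧ Nonempty (resolved P.obj.obj ≅ M) := by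
  obtain ⟨X, hX, ⟨e⟩⟩ := h
  obtain ⟨P, hP⟩ := exists_isPsi_of_arrow (R := R) X
  obtain ⟨e'⟩ := hP.exists_iso
  exact ⟨P, ⟨X, hX, hP⟩, ⟨e' ≪≫ e⟩⟩

/-- Converse to `psiPreimage.map_phi`. It needs closure under homotopy because `resolved P`
determines `Ψ(P)` only up to homotopy equivalence. -/
lemma HomotopyClosed.psiPreimage [IsIdempotentComplete C] {T : ObjectProperty (Arrow C)}
    (hT : HomotopyClosed T) {P : PZero R C} (h : T.map (Phi R C) (resolved P.obj.obj)) :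
    psiPreimage R T P := by
  obtain ⟨Y, hY, ⟨e⟩⟩ := h
  obtain ⟨X, hX⟩ := exists_isPsi P
  obtain ⟨e'⟩ := hX.exists_iso
  exact ⟨X, hT.of_phi_iso (e ≪≫ e') hY, hX⟩

lemma exists_iso_resolved_stalk (A : C) :
    Nonempty (resolved (stalk R A).obj.obj ≅ (yonedaFP R C).obj A) :=
  ⟨(HomologicalComplex.singleObjOpcyclesSelfIso (.up ℤ) 0 ((yonedaFP R C).obj A)).symm⟩

end FinitelyPresented

lemma HasCoresolution.of_iso {E : Type w} [Category.{w'} E] [HasZeroMorphisms E]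
    {S : ObjectProperty (ShortComplex E)} {T : ObjectProperty E} {n : ℕ} {X Y : E}
    (h : HasCoresolution S T n X) (e : X ≅ Y) : HasCoresolution S T n Y := by
  cases n with
  | zero =>
    obtain ⟨Z, hZ, ⟨i⟩⟩ := h
    exact ⟨Z, hZ, ⟨e.symm ≪≫ i⟩⟩
  | succ n =>
    obtain ⟨K, hK, ⟨i⟩, h₂, h₃⟩ := h
    exact ⟨K, hK, ⟨i ≪≫ e⟩, h₂, h₃⟩

lemma DegSplit.comp_iso {A : Type u} [Category.{v} A] [Preadditive A]
    {S : ShortComplex (CochainComplex A ℤ)} (hS : DegSplit S) {Y : CochainComplex A ℤ}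
    (e : S.X₃ ≅ Y) :
    DegSplit (ShortComplex.mk S.f (S.g ≫ e.hom) (by rw [← Category.assoc, S.zero, zero_comp])) := by
  obtain ⟨r, s, h⟩ := hS
  have he (i : ℤ) : e.hom.f i ≫ e.inv.f i = 𝟙 _ := by
    rw [← HomologicalComplex.comp_f, e.hom_inv_id, HomologicalComplex.id_f]
  have he' (i : ℤ) : e.inv.f i ≫ e.hom.f i = 𝟙 _ := by
    rw [← HomologicalComplex.comp_f, e.inv_hom_id, HomologicalComplex.id_f]
  refine ⟨r, fun i => e.inv.f i ≫ s i, fun i => ⟨(h i).1, ?_, ?_⟩⟩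
  · change (e.inv.f i ≫ s i) ≫ S.g.f i ≫ e.hom.f i = 𝟙 _
    rw [Category.assoc, reassoc_of% (h i).2.1, he']
  · change r i ≫ S.f.f i + (S.g.f i ≫ e.hom.f i) ≫ e.inv.f i ≫ s i = 𝟙 _
    rw [Category.assoc, reassoc_of% (he i)]
    exact (h i).2.2

lemma degSplit_triangleRotateShortComplex {A : Type u} [Category.{v} A] [Preadditive A]
    [HasBinaryBiproducts A] {K L : CochainComplex A ℤ} (φ : K ⟶ L) :
    DegSplit (mappingCone.triangleRotateShortComplex φ) :=
  degSplit_iff.2 fun i => ⟨mappingCone.triangleRotateShortComplexSplitting φ i⟩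

/-! ### The degreewise split structure on bounded above complexes -/

section BoundedAbove

variable {R : Type v} [CommRing R] {C : Type u} [Category.{v} C] [Preadditive C] [Linear R C]

lemma boundedAbove_shift {P : CochainComplex (FPMod R C) ℤ} (hP : boundedAbove R C P) (n : ℤ) :
    boundedAbove R C (P⟦n⟧) := by
  obtain ⟨m, hm⟩ := hP
  exact ⟨m - n, fun i hi => hm (i + n) (by omega)⟩

lemma DegSplit.boundedAbove {S : ShortComplex (CochainComplex (FPMod R C) ℤ)} (hS : DegSplit S)
    (h₁ : boundedAbove R C S.X₁) (h₃ : boundedAbove R C S.X₃) : boundedAbove R C S.X₂ := by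
  obtain ⟨m, hm⟩ := h₁
  obtain ⟨n, hn⟩ := h₃
  obtain ⟨r, s, h⟩ := hS
  refine ⟨max m n, fun i hi => ?_⟩
  rw [IsZero.iff_id_eq_zero, ← (h i).2.2, (hm i (by omega)).eq_of_tgt (r i) 0,
    (hn i (by omega)).eq_of_src (s i) 0, zero_comp, comp_zero, add_zero]

lemma degreewiseSplit_iff (K : ShortComplex (CMinus R C)) :
    degreewiseSplit R C K ↔ DegSplit (K.map (boundedAbove R C).ι) :=
  (degSplit_iff (S := K.map (boundedAbove R C).ι)).symm

lemma relProjective_degreewiseSplit {P : CMinus R C} (hP : ∀ Y, HomVanishes P.obj Y 1) :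
    RelProjective (degreewiseSplit R C) P := by
  intro K hK f
  obtain ⟨g, hg⟩ := ((degreewiseSplit_iff K).1 hK).exists_lift (hP _) f.hom
  exact ⟨ObjectProperty.homMk g, ObjectProperty.hom_ext _ hg⟩

lemma conflPZero_iff (K : ShortComplex (PZero R C)) :
    conflPZero R C K ↔ DegSplit ((K.map (projRes R C).ι).map (boundedAbove R C).ι) :=
  degreewiseSplit_iff _

end BoundedAbove

/-! ### `Ext` in `C⁻(mod(C))` -/

section Main

variable {R : Type v} [CommRing R] {C : Type u} [Category.{v} C] [Preadditive C] [Linear R C]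
  [HasZeroObject C] [HasBinaryBiproducts C] [(finPres R C).IsClosedUnderKernels]

lemma kernelCokernelPairs_degreewiseSplit : KernelCokernelPairs (degreewiseSplit R C) where
  mono K hK := by
    have := ((degreewiseSplit_iff K).1 hK).shortExact.mono_f
    exact (boundedAbove R C).ι.mono_of_mono_map this
  epi K hK := by
    have := ((degreewiseSplit_iff K).1 hK).shortExact.epi_g
    exact (boundedAbove R C).ι.epi_of_epi_map this
  lift K hK W t ht := by
    obtain ⟨u, hu⟩ := kernelCokernelPairs_shortExactSeq.lift _
      ((degreewiseSplit_iff K).1 hK).shortExact _ t.hom (congrArg (fun t => t.hom) ht)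
    exact ⟨ObjectProperty.homMk u, ObjectProperty.hom_ext _ hu⟩
  desc K hK W t ht := by
    obtain ⟨u, hu⟩ := kernelCokernelPairs_shortExactSeq.desc _
      ((degreewiseSplit_iff K).1 hK).shortExact _ t.hom (congrArg (fun t => t.hom) ht)
    exact ⟨ObjectProperty.homMk u, ObjectProperty.hom_ext _ hu⟩

lemma boundedAbove_mappingCone {K L : CochainComplex (FPMod R C) ℤ} (φ : K ⟶ L)
    (hK : boundedAbove R C K) (hL : boundedAbove R C L) : boundedAbove R C (mappingCone φ) :=
  (degSplit_triangleRotateShortComplex φ).boundedAbove hL (boundedAbove_shift hK 1)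

/-- The resolution of a complex by cones over the identities of its shifts. -/
def coneResolution (P : CMinus R C) : RelResolution (degreewiseSplit R C) P :=
  let K (k : ℕ) : CochainComplex (FPMod R C) ℤ := P.obj⟦-(k : ℤ)⟧
  have hK (k : ℕ) : boundedAbove R C (K k) := boundedAbove_shift P.property _
  -- Identifies the right end of the cone sequence of `K (k + 1)` with the previous syzygy `K k`.
  let e (k : ℕ) : (K (k + 1))⟦(1 : ℤ)⟧ ≅ K k :=
    ((CategoryTheory.shiftFunctorAdd' _ (-((k + 1 : ℕ) : ℤ)) 1 (-(k : ℤ)) (by push_cast; ring)).app P.obj).symm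
  { syz k := ⟨K k, hK k⟩
    proj k := ⟨mappingCone (𝟙 (K (k + 1))), boundedAbove_mappingCone _ (hK _) (hK _)⟩
    syzZeroIso := (boundedAbove R C).isoMk ((CategoryTheory.shiftFunctorZero' _ (-((0 : ℕ) : ℤ)) (by simp)).app P.obj)
    incl k := ObjectProperty.homMk (mappingCone.inr _)
    quot k := ObjectProperty.homMk
      ((mappingCone.triangleRotateShortComplex (𝟙 (K (k + 1)))).g ≫ (e k).hom)
    zero k := ObjectProperty.hom_ext _ (((Category.assoc _ _ _).symm.trans
      (congrArg (· ≫ (e k).hom) (mappingCone.triangleRotateShortComplex (𝟙 (K (k + 1)))).zero)).trans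
        zero_comp)
    conflation k := (degreewiseSplit_iff _).2
      ((degSplit_triangleRotateShortComplex (𝟙 (K (k + 1)))).comp_iso (e k))
    projective k := relProjective_degreewiseSplit fun Y => homVanishes_mappingCone_id _ Y 1 }

/-- By `coneResolution`, vanishing means that every map `P⟦-(k+1)⟧ ⟶ Q` extends over the cone of the
identity, i.e. is null-homotopic. -/
lemma extSuccVanishes_degreewiseSplit_iff (P Q : CMinus R C) (k : ℕ) :
    ExtSuccVanishes (degreewiseSplit R C) k P Q ↔ HomVanishes P.obj Q.obj (k + 1) := by
  rw [(coneResolution P).extSuccVanishes_iff kernelCokernelPairs_degreewiseSplit,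
    homVanishes_iff_shift P.obj Q.obj (-((k + 1 : ℕ) : ℤ)) (k + 1) (by push_cast; ring)]
  simp only [← exists_inr_comp_iff]
  constructor
  · intro h f
    obtain ⟨g, hg⟩ := h (ObjectProperty.homMk f)
    exact ⟨g.hom, congrArg (fun t => t.hom) hg⟩
  · intro h f
    obtain ⟨g, hg⟩ := h f.hom
    exact ⟨ObjectProperty.homMk g, ObjectProperty.hom_ext _ hg⟩

lemma PZero.extSuccVanishes_iff (P Q : PZero R C) (k : ℕ) :
    ExtSuccVanishes (degreewiseSplit R C) k P.obj Q.obj ↔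
      ExtSuccVanishes (exactSeq R C) k (resolved P.obj.obj) (resolved Q.obj.obj) := by
  rw [extSuccVanishes_degreewiseSplit_iff, exactSeq_eq,
    P.isProjRes.extSuccVanishes_iff Q.isProjRes]

/-! ### The exact category `P⁰(mod(C))` -/

variable (R C) in
/-- The functor sending a projective resolution to the object it resolves. -/
def resolvedFunctor : PZero R C ⥤ FPMod R C :=
  (projRes R C).ι ⋙ (boundedAbove R C).ι ⋙ HomologicalComplex.opcyclesFunctor _ _ 0

instance : (resolvedFunctor R C).PreservesZeroMorphisms where
  map_zero _ _ := HomologicalComplex.opcyclesMap_zero _ _ _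

lemma exactSeq_map_resolvedFunctor {K : ShortComplex (PZero R C)} (hK : conflPZero R C K) :
    exactSeq R C (K.map (resolvedFunctor R C)) := by
  rw [exactSeq_eq]
  exact ((conflPZero_iff K).1 hK).shortExact_resolved K.X₁.isProjRes K.X₂.isProjRes
    K.X₃.isProjRes

lemma exists_conflPZero {S : ShortComplex (FPMod R C)} (hS : exactSeq R C S) {K P : PZero R C}
    (e₁ : (resolvedFunctor R C).obj K ≅ S.X₁) (e₃ : (resolvedFunctor R C).obj P ≅ S.X₃) :
    ∃ (L : PZero R C) (f : K ⟶ L) (g : L ⟶ P) (w : f ≫ g = 0),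
      conflPZero R C (ShortComplex.mk f g w) ∧
        Nonempty ((resolvedFunctor R C).obj L ≅ S.X₂) := by
  rw [exactSeq_eq] at hS
  obtain ⟨L, f, g, w, hL, hsplit, e⟩ :=
    exists_degSplit_of_shortExact K.isProjRes P.isProjRes hS e₁ e₃
  exact ⟨hL.toPZero, ObjectProperty.homMk (ObjectProperty.homMk f),
    ObjectProperty.homMk (ObjectProperty.homMk g),
    ObjectProperty.hom_ext _ (ObjectProperty.hom_ext _ w), (conflPZero_iff _).2 hsplit, e⟩

lemma exists_resolvedFunctor_iso (M : FPMod R C) :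
    ∃ P : PZero R C, Nonempty ((resolvedFunctor R C).obj P ≅ M) := by
  obtain ⟨P, hP, e⟩ := exists_isProjRes_resolved M
  exact ⟨hP.toPZero, e⟩

/-- If `P` is relatively projective, lift a projective cover sequence of its resolved object to a
conflation ending in `P`; it splits, so that object is a retract of a projective. Conversely, the
obstruction to lifting lies in an `Ext¹` out of a projective. -/
lemma relProjective_conflPZero_iff (P : PZero R C) :
    RelProjective (conflPZero R C) P ↔
      RelProjective (exactSeq R C) ((resolvedFunctor R C).obj P) := by
  rw [exactSeq_eq, relProjective_shortExactSeq_iff]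
  constructor
  · intro h
    obtain ⟨K, ⟨e⟩⟩ := exists_resolvedFunctor_iso
      (kernel (Projective.π ((resolvedFunctor R C).obj P)))
    obtain ⟨L, f, g, w, hL, ⟨e'⟩⟩ := exists_conflPZero
      (S := ShortComplex.mk _ _ (kernel.condition (Projective.π ((resolvedFunctor R C).obj P))))
      (by rw [exactSeq_eq]; exact shortExact_kernel_ι _) e (Iso.refl _)
    obtain ⟨s, hs⟩ := h _ hL (𝟙 P)
    have h1 : Projective ((resolvedFunctor R C).obj L) :=
      Projective.of_iso e'.symm (Projective.projective_over _)
    have h2 : (resolvedFunctor R C).map s ≫ (resolvedFunctor R C).map g = 𝟙 _ := by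
      rw [← Functor.map_comp, ← (resolvedFunctor R C).map_id]
      exact congrArg _ hs
    exact ⟨fun t p hp => ⟨(resolvedFunctor R C).map s ≫
      Projective.factorThru ((resolvedFunctor R C).map g ≫ t) p, by
        rw [Category.assoc, Projective.factorThru_comp, reassoc_of% h2]⟩⟩
  · intro h K hK f
    obtain ⟨g, hg⟩ := ((conflPZero_iff K).1 hK).exists_lift
      (P.isProjRes.homVanishes_one K.X₁.isProjRes h) f.hom.hom
    exact ⟨ObjectProperty.homMk (ObjectProperty.homMk g),
      ObjectProperty.hom_ext _ (ObjectProperty.hom_ext _ hg)⟩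

lemma relProjDimLE_conflPZero_iff (n : ℕ) (P : PZero R C) :
    RelProjDimLE (conflPZero R C) n P ↔
      RelProjDimLE (exactSeq R C) n ((resolvedFunctor R C).obj P) := by
  induction n generalizing P with
  | zero => exact relProjective_conflPZero_iff P
  | succ n ih =>
    constructor
    · rintro ⟨K, hK, ⟨e⟩, h₂, h₁⟩
      exact ⟨_, exactSeq_map_resolvedFunctor hK, ⟨(resolvedFunctor R C).mapIso e⟩,
        (relProjective_conflPZero_iff _).1 h₂, (ih _).1 h₁⟩
    · rintro ⟨S, hS, ⟨e⟩, h₂, h₁⟩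
      obtain ⟨K, ⟨e₁⟩⟩ := exists_resolvedFunctor_iso S.X₁
      obtain ⟨L, f, g, w, hL, ⟨e₂⟩⟩ := exists_conflPZero hS e₁ e.symm
      exact ⟨_, hL, ⟨Iso.refl _⟩, (relProjective_conflPZero_iff _).2 (h₂.of_iso e₂.symm),
        (ih _).2 (h₁.of_iso e₁.symm)⟩

variable {T : ObjectProperty (Arrow C)}

lemma HasCoresolution.map_resolvedFunctor {n : ℕ} {P : PZero R C}
    (h : HasCoresolution (conflPZero R C) (psiPreimage R T) n P) :
    HasCoresolution (exactSeq R C) (T.map (Phi R C)) n ((resolvedFunctor R C).obj P) := by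
  induction n generalizing P with
  | zero =>
    obtain ⟨Q, hQ, ⟨e⟩⟩ := h
    exact ⟨_, hQ.map_phi, ⟨(resolvedFunctor R C).mapIso e⟩⟩
  | succ n ih =>
    obtain ⟨K, hK, ⟨e⟩, h₂, h₃⟩ := h
    exact ⟨_, exactSeq_map_resolvedFunctor hK, ⟨(resolvedFunctor R C).mapIso e⟩, h₂.map_phi,
      ih h₃⟩

instance : (T.map (Phi R C)).IsClosedUnderIsomorphisms where
  of_iso e := fun ⟨X, hX, ⟨e'⟩⟩ => ⟨X, hX, ⟨e' ≪≫ e⟩⟩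

/-- Each short exact sequence is lifted by the horseshoe lemma starting from the given `P` on the
left. Homotopy closure puts the middle term in the preimage of `T`, and the induction goes on with
the chosen resolution of the right end. -/
lemma HomotopyClosed.hasCoresolution [IsIdempotentComplete C] (hT : HomotopyClosed T) {n : ℕ}
    {P : PZero R C}
    (h : HasCoresolution (exactSeq R C) (T.map (Phi R C)) n ((resolvedFunctor R C).obj P)) :
    HasCoresolution (conflPZero R C) (MapsTilting.psiPreimage R T) n P := by
  induction n generalizing P with
  | zero =>
    obtain ⟨M, hM, ⟨e⟩⟩ := h
    exact ⟨P, hT.psiPreimage (ObjectProperty.prop_of_iso _ e.symm hM), ⟨Iso.refl _⟩⟩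
  | succ n ih =>
    obtain ⟨S, hS, ⟨e⟩, h₂, h₃⟩ := h
    obtain ⟨Q, ⟨e₃⟩⟩ := exists_resolvedFunctor_iso S.X₃
    obtain ⟨L, f, g, w, hL, ⟨e₂⟩⟩ := exists_conflPZero hS e.symm e₃
    exact ⟨_, hL, ⟨Iso.refl _⟩, hT.psiPreimage (ObjectProperty.prop_of_iso _ e₂.symm h₂),
      ih (h₃.of_iso e₃.symm)⟩

/-! ### Comparison of the two notions of tilting -/

variable (R T) in
lemma rpdim_le_iff (n : ℕ) : (∀ P, psiPreimage R T P → RelProjDimLE (conflPZero R C) n P) ↔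
    ∀ M, T.map (Phi R C) M → RelProjDimLE (exactSeq R C) n M := by
  refine ⟨fun h M hM => ?_, fun h P hP => (relProjDimLE_conflPZero_iff n P).2 (h _ hP.map_phi)⟩
  obtain ⟨P, hP, ⟨e⟩⟩ := exists_psiPreimage hM
  exact ((relProjDimLE_conflPZero_iff n P).1 (h P hP)).of_iso e

lemma IsRelTilting.isTilting (h : IsRelTilting R T) : IsTilting R C (T.map (Phi R C)) where
  pdim M hM := by
    obtain ⟨P, hP, ⟨e⟩⟩ := exists_psiPreimage hM
    obtain ⟨n, hn⟩ := h.rpdim P hP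
    exact ⟨n, ((relProjDimLE_conflPZero_iff n P).1 hn).of_iso e⟩
  ext M N hM hN k := by
    obtain ⟨P, hP, ⟨e⟩⟩ := exists_psiPreimage hM
    obtain ⟨Q, hQ, ⟨e'⟩⟩ := exists_psiPreimage hN
    exact ((P.extSuccVanishes_iff Q k).1 (h.ext P Q hP hQ k)).of_iso e e'
  cores A := by
    obtain ⟨n, hn⟩ := h.cores A
    obtain ⟨e⟩ := exists_iso_resolved_stalk (R := R) A
    exact ⟨n, hn.map_resolvedFunctor.of_iso e⟩

lemma IsTilting.isRelTilting [IsIdempotentComplete C] (hT : HomotopyClosed T)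
    (h : IsTilting R C (T.map (Phi R C))) : IsRelTilting R T where
  rpdim P hP := by
    obtain ⟨n, hn⟩ := h.pdim _ hP.map_phi
    exact ⟨n, (relProjDimLE_conflPZero_iff n P).2 hn⟩
  ext P Q hP hQ k := (P.extSuccVanishes_iff Q k).2 (h.ext _ _ hP.map_phi hQ.map_phi k)
  cores A := by
    obtain ⟨n, hn⟩ := h.cores A
    obtain ⟨e⟩ := exists_iso_resolved_stalk (R := R) A
    exact ⟨n, hT.hasCoresolution (hn.of_iso e.symm)⟩

end Main

end MapsTilting

end

open MapsTilting
theorem mainTheorem1 {R : Type v} [CommRing R] [IsArtinianRing R]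
    {I : Type v} [AddCommGroup I] [Module R I] (i : R ⧸ Ring.jacobson R →ₗ[R] I)
    (hi : IsInjectiveEnvelope i)
    {C : Type u} [Category.{v} C] [Preadditive C] [Linear R C] [HasFiniteBiproducts C]
    [IsIdempotentComplete C] [EssentiallySmall.{v} C]
    (hC : IsDualizing R C I) (hKS : IsKrullSchmidt C) (T : ObjectProperty (Arrow C)) :
    (IsRelTilting R T → IsTilting R C (T.map (Phi R C))) ∧
    (HomotopyClosed T → (IsRelTilting R T ↔ IsTilting R C (T.map (Phi R C)))) ∧
    ∀ n : ℕ, (∀ P, psiPreimage R T P → RelProjDimLE (conflPZero R C) n P) ↔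
      ∀ M, T.map (Phi R C) M → RelProjDimLE (exactSeq R C) n M := by
  have := hasBinaryBiproducts_of_finite_biproducts C
  have := hC.isClosedUnderKernels
  exact ⟨IsRelTilting.isTilting, fun hT => ⟨IsRelTilting.isTilting, IsTilting.isRelTilting hT⟩,
    rpdim_le_iff R T⟩
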